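/- Fix $m\ge 1$. Let $\vec\beta_p\in\mathbb R^m$ ($p\ge 2$) satisfy $\vec\beta_p=0$ for odd $p$ and $\sum_{p\ge2}2^p\vec\beta_p(j)^2<\infty$ for every $j$; let $\vec h\in\mathbb R^m$, and let $Q$ be a positive semidefinite $m\times m$ matrix with entries in $[-1,1]$ and unit diagonal. Write $\langle A,B\rangle=\mathrm{Tr}(AB)$, let $\odot$ and $A^{\circ p}$ denote entrywise products and powers, and put $\xi'(A)=\sum_{p\ge 2}p\,(\vec\beta_p\otimes\vec\beta_p)\odot A^{\circ(p-1)}$. Consider right-continuous nondecreasing functions $x:[0,m]\to[0,1]$ with $x(m)=1$ (an atom $x(0)>0$ at $0$ is allowed) and Lipschitz paths $\Phi$ from $[0,m]$ to the positive semidefinite matrices, nondecreasing in the positive semidefinite order, with $\Phi(0)=0$ and $\Phi(m)=Q$. Put $t_x=\inf\{t:x(t)=1\}$ and $\hat\Phi(t)=\int_t^m x(s)\Phi'(s)\,ds$. If $|Q-\Phi(t_x)|>0$ (where $|\cdot|$ is the determinant), set $$\mathscr C(x,\Phi)=\frac12\Big[\int_0^m x(t)\langle \xi'(\Phi(t))+\vec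 h\vec h^T,\Phi'(t)\rangle dt+\log|Q-\Phi(\hat T)|+\int_0^{\hat T}\langle\hat\Phi(t)^{-1},\Phi'(t)\rangle dt\Big],$$ where $t_x<\hat T<m$ is any number with $|Q-\Phi(\hat T)|>0$ (the value does not depend on $\hat T$). Let $(x,\Phi)$ attain the infimum of $\mathscr C$ over all pairs as above whose path is $1$-Lipschitz (in the entrywise sup norm) with $\mathrm{Tr}\,\Phi(t)=t$ for all $t$; here the path $\Phi$ of the pair $(x,\Phi)$ itself is continuously differentiable on $[0,m]$ with Lipschitz derivative and is only required to satisfy $\mathrm{Tr}\,\Phi(t)=t$ for $t\in\mathrm{supp}\,\mu_P$, where $\mu_P$ is the probability measure on $[0,m]$ with $\mu_P([0,q])=x(q)$. Suppose that $0\in\mathrm{supp}\,\mu_P$ and $$2\langle\vec\beta_2\otimes\vec\beta_2,\Phi'(0)^{\circ2}\rangle\ne\langle\hat\Phi(0)^{-1}\Phi'(0),\hat\Phi(0)^{-1}\Phi'(0)\rangle .$$ Then there is $\hat q\in(0,m]$ with $\mu_P([0,\hat q])=\mu_P(\{0\})$ and $\mathrm{supp}\,\mu_P\cap[0,\hat q)=\{0\}$;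 in particular, $0$ is an isolated point of $\mathrm{supp}\,\mu_P$. -/

import Mathlib

open MeasureTheory Set
open scoped Matrix

noncomputable section

namespace VectorSpin

/-- The pairing `⟨A, B⟩ = Tr (A B)`; on symmetric matrices it is the Frobenius inner product. -/
def pairing {m : ℕ} (A B : Matrix (Fin m) (Fin m) ℝ) : ℝ := (A * B).trace

/-- The standing assumptions on the inverse temperatures `β p j` (`p ≥ 2`, `j` a copy): only even
`p` occur, and `∑ 2 ^ p β_p(j) ^ 2 < ∞` for every copy `j`. -/
structure IsMixture {m : ℕ} (β : ℕ → Fin m → ℝ) : Prop where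
  even : ∀ p, 3 ≤ p → Odd p → β p = 0
  summable : ∀ j, Summable fun p : ℕ => (2 : ℝ) ^ (p + 2) * β (p + 2) j ^ 2

/-- The matrix `ξ'(A) = ∑_{p ≥ 2} p (β_p ⊗ β_p) ⊙ A^{∘(p-1)}`. -/
def xiDeriv {m : ℕ} (β : ℕ → Fin m → ℝ) (A : Matrix (Fin m) (Fin m) ℝ) :
    Matrix (Fin m) (Fin m) ℝ :=
  Matrix.of fun i j => ∑' p : ℕ, ((p : ℝ) + 2) * (β (p + 2) i * β (p + 2) j) * A i j ^ (p + 1)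

/-- The possible self-overlap constraints: positive semidefinite matrices with entries in `[-1,1]`
and unit diagonal. -/
structure IsConstraint {m : ℕ} (Q : Matrix (Fin m) (Fin m) ℝ) : Prop where
  posSemidef : Q.PosSemidef
  mem_Icc : ∀ i j, Q i j ∈ Icc (-1 : ℝ) 1
  diag : ∀ i, Q i i = 1

/-- Functional order parameters: right-continuous nondecreasing `x : [0,m] → [0,1]`, `x m = 1`.
The normalization at the left end is `x (0-) = 0`, so that `x 0 > 0` (an atom at `0`) is allowed.
Only the values of `x` on `[0,m]` matter. -/
structure IsOrderParameter (m : ℕ) (x : ℝ → ℝ) : Prop where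
  monotoneOn : MonotoneOn x (Icc 0 (m : ℝ))
  rightContinuous : ∀ t ∈ Ico 0 (m : ℝ), ContinuousWithinAt x (Ici t) t
  nonneg : ∀ t ∈ Icc 0 (m : ℝ), 0 ≤ x t
  right_end : x m = 1

/-- `μ` is the measure on `[0,m]` with distribution function `x`, i.e. `μ [0,q] = x q`. -/
structure HasDistribution (m : ℕ) (x : ℝ → ℝ) (μ : Measure ℝ) : Prop where
  measure_compl : μ (Icc 0 (m : ℝ))ᶜ = 0
  measure_Icc : ∀ q ∈ Icc 0 (m : ℝ), μ (Icc 0 q) = ENNReal.ofReal (x q)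

/-- `t_x = inf {t ∈ [0,m] : x t = 1}`. -/
def topPoint (m : ℕ) (x : ℝ → ℝ) : ℝ := sInf {t | t ∈ Icc 0 (m : ℝ) ∧ x t = 1}

/-- Monotone paths `[0,m] → 𝕊₊ᵐ` from `0` to `Q`, for the positive semidefinite order. -/
structure IsMonotonePath {m : ℕ} (Q : Matrix (Fin m) (Fin m) ℝ)
    (Φ : ℝ → Matrix (Fin m) (Fin m) ℝ) : Prop where
  posSemidef : ∀ t ∈ Icc 0 (m : ℝ), (Φ t).PosSemidef
  monotone : ∀ s ∈ Icc 0 (m : ℝ), ∀ t ∈ Icc 0 (m : ℝ), s ≤ t → (Φ t - Φ s).PosSemidef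
  left_end : Φ 0 = 0
  right_end : Φ m = Q

/-- The derivative `Φ'(t)` along `[0,m]`, one-sided at the two end points. -/
def pathDeriv {m : ℕ} (Φ : ℝ → Matrix (Fin m) (Fin m) ℝ) (t : ℝ) : Matrix (Fin m) (Fin m) ℝ :=
  Matrix.of fun i j => derivWithin (fun s => Φ s i j) (Icc 0 (m : ℝ)) t

/-- The class `𝓜₀`: 1-Lipschitz monotone paths (for the entrywise sup norm) with `Tr Φ(t) = t`. -/
structure IsTracePath {m : ℕ} (Q : Matrix (Fin m) (Fin m) ℝ)
    (Φ : ℝ → Matrix (Fin m) (Fin m) ℝ) : Prop extends IsMonotonePath Q Φ where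
  lipschitz : ∀ i j, LipschitzOnWith 1 (fun t => Φ t i j) (Icc 0 (m : ℝ))
  trace : ∀ t ∈ Icc 0 (m : ℝ), (Φ t).trace = t

/-- The class `𝓜`: continuously differentiable Lipschitz monotone paths with Lipschitz derivative,
normalized by `Tr Φ(t) = t` on the support of `μ` only. -/
structure IsSmoothPath {m : ℕ} (Q : Matrix (Fin m) (Fin m) ℝ) (μ : Measure ℝ)
    (Φ : ℝ → Matrix (Fin m) (Fin m) ℝ) : Prop extends IsMonotonePath Q Φ where
  differentiable : ∀ i j, DifferentiableOn ℝ (fun t => Φ t i j) (Icc 0 (m : ℝ))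
  lipschitz : ∃ K, ∀ i j, LipschitzOnWith K (fun t => Φ t i j) (Icc 0 (m : ℝ))
  lipschitz_deriv : ∃ K, ∀ i j, LipschitzOnWith K (fun t => pathDeriv Φ t i j) (Icc 0 (m : ℝ))
  trace : ∀ t ∈ μ.support, (Φ t).trace = t

/-- `Φ̂(t) = ∫_t^m x(s) Φ'(s) ds`. -/
def hatPath {m : ℕ} (x : ℝ → ℝ) (Φ : ℝ → Matrix (Fin m) (Fin m) ℝ) (t : ℝ) :
    Matrix (Fin m) (Fin m) ℝ :=
  Matrix.of fun i j => ∫ s in t..(m : ℝ), x s * pathDeriv Φ s i j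

/-- The cut-offs `t_x < T < m` at which `log |Q - Φ(T)|` makes sense. They exist as soon as
`|Q - Φ(t_x)| > 0`, and the functional below takes the same value at all of them. -/
def IsCutoff {m : ℕ} (Q : Matrix (Fin m) (Fin m) ℝ) (x : ℝ → ℝ)
    (Φ : ℝ → Matrix (Fin m) (Fin m) ℝ) (T : ℝ) : Prop :=
  topPoint m x < T ∧ T < m ∧ 0 < (Q - Φ T).det

/-- The Crisanti-Sommers functional, written with the cut-off `T`. -/
def crisantiSommers {m : ℕ} (β : ℕ → Fin m → ℝ) (h : Fin m → ℝ) (T : ℝ) (x : ℝ → ℝ)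
    (Φ : ℝ → Matrix (Fin m) (Fin m) ℝ) : ℝ :=
  (1 / 2) * ((∫ t in (0 : ℝ)..(m : ℝ),
        x t * pairing (xiDeriv β (Φ t) + Matrix.vecMulVec h h) (pathDeriv Φ t))
      + Real.log (Φ m - Φ T).det
      + ∫ t in (0 : ℝ)..T, pairing (hatPath x Φ t)⁻¹ (pathDeriv Φ t))

/-- `(x, Φ)`, with `Φ` in the class `𝓜`, attains the infimum in the Crisanti-Sommers formula: the
infimum of the functional over all order parameters `y` and all paths `Ψ` in `𝓜₀` subject to
`|Q - Ψ(t_y)| > 0`. Here `μ` is the measure with distribution function `x`. -/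
structure IsMinimizer {m : ℕ} (β : ℕ → Fin m → ℝ) (h : Fin m → ℝ)
    (Q : Matrix (Fin m) (Fin m) ℝ) (x : ℝ → ℝ) (μ : Measure ℝ)
    (Φ : ℝ → Matrix (Fin m) (Fin m) ℝ) : Prop where
  orderParameter : IsOrderParameter m x
  distribution : HasDistribution m x μ
  path : IsSmoothPath Q μ Φ
  det_pos : 0 < (Q - Φ (topPoint m x)).det
  le : ∀ (y : ℝ → ℝ) (Ψ : ℝ → Matrix (Fin m) (Fin m) ℝ), IsOrderParameter m y →
    IsTracePath Q Ψ → 0 < (Q - Ψ (topPoint m y)).det →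
    ∀ S T : ℝ, IsCutoff Q x Φ S → IsCutoff Q y Ψ T →
      crisantiSommers β h S x Φ ≤ crisantiSommers β h T y Ψ

end VectorSpin

end

/-! At a minimizer the first variation of the functional along any direction has a sign. With
`G(t) = ξ'(Φ(t)) - ∫₀ᵗ Φ̂⁻¹ Φ' Φ̂⁻¹ ds`, varying `x` gives `∫₀^q ⟨G + h hᵀ, Φ'⟩ dt ≤ 0` for all
small `q` as soon as `x > 0` off the origin, while damping the path on `(0, q)` gives
`∫ η ⟨G + h hᵀ, Φ⟩ dμ ≥ 0` for a cut-off `η` supported there. Since `G(0) = 0`, the quantities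
`⟨G, Φ'⟩` and `⟨G, Φ⟩` are equivalent to `γ t` and `γ t²` at the origin, where
`γ = ⟨G'(0), Φ'(0)⟩` is the difference of the two sides of the inequation assumed on `β 2`. As
`⟨h hᵀ, Φ⟩ ≥ 0`, the first condition forces `γ ≤ 0`. If `γ < 0`, it bounds `⟨h hᵀ, Φ(t)⟩` by
`-γ t² / 2` up to smaller terms, so `⟨G + h hᵀ, Φ⟩ < 0` near the origin, and the second condition
leaves no mass of `μ` on a punctured neighbourhood of `0`. Hence `γ ≠ 0` makes `x` constant near
the origin.
-/

noncomputable section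

namespace VectorSpin

open Filter Topology
open scoped MatrixOrder Matrix.Norms.Operator

section PosSemidef

variable {n : Type*} {A B : Matrix n n ℝ}

lemma abs_apply_le_half_diag_add [Finite n] (hA : A.PosSemidef) (i j : n) :
    |A i j| ≤ (A i i + A j j) / 2 := by
  classical
  have := Fintype.ofFinite n
  have hsymm : A j i = A i j := hA.1.apply i j
  have quadratic (a : ℝ) : 0 ≤ A i i + 2 * a * A i j + a * a * A j j := by
    have := hA.dotProduct_mulVec_nonneg (Pi.single i 1 + a • Pi.single j 1)
    simp only [star_trivial, Matrix.mulVec_add, Matrix.mulVec_smul, Matrix.mulVec_single_one,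
      add_dotProduct, dotProduct_add, smul_dotProduct, dotProduct_smul, single_one_dotProduct,
      Matrix.col_apply, smul_eq_mul, hsymm] at this
    linarith
  rw [abs_le]
  constructor <;> linarith [quadratic 1, quadratic (-1)]

lemma abs_apply_le_trace [Fintype n] (hA : A.PosSemidef) (i j : n) : |A i j| ≤ A.trace := by
  have diag_le (i : n) : A i i ≤ A.trace :=
    Finset.single_le_sum (f := fun i => A i i) (fun k _ => hA.diag_nonneg) (Finset.mem_univ i)
  linarith [abs_apply_le_half_diag_add hA i j, diag_le i, diag_le j]

lemma posDef_of_posSemidef_sub [Fintype n] [DecidableEq n] (hA : A.PosSemidef) (hdet : A.det ≠ 0)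
    (hAB : (B - A).PosSemidef) : B.PosDef := by
  simpa using (hA.posDef_iff_det_ne_zero.2 hdet).add_posSemidef hAB

lemma isClosed_setOf_posSemidef [Finite n] : IsClosed {A : Matrix n n ℝ | A.PosSemidef} := by
  have := Fintype.ofFinite n
  simp only [Matrix.posSemidef_iff_dotProduct_mulVec, ofPred_and, ofPred_forall]
  refine (isClosed_eq (continuous_id.matrix_conjTranspose) continuous_id).inter
    (isClosed_iInter fun v => isClosed_le continuous_const ?_)
  fun_prop

lemma posSemidef_integral [Fintype n] {F : ℝ → Matrix n n ℝ} {a b : ℝ} (hab : a ≤ b)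
    (hF : ∀ t ∈ Icc a b, (F t).PosSemidef) : (∫ t in a..b, F t).PosSemidef := by
  classical
  have : @ClosedIciTopology (Matrix n n ℝ) PseudoMetricSpace.toUniformSpace.toTopologicalSpace _ :=
    ⟨fun A => isClosed_setOf_posSemidef.preimage (continuous_sub_right A)⟩
  rw [← Matrix.nonneg_iff_posSemidef, intervalIntegral.integral_of_le hab]
  exact integral_nonneg_of_ae ((ae_restrict_mem measurableSet_Ioc).mono fun t ht =>
    (hF t (Ioc_subset_Icc_self ht)).nonneg)

lemma posSemidef_of_hasDerivWithinAt [Finite n] {F : ℝ → Matrix n n ℝ} {s : Set ℝ}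
    (hF : ∀ a ∈ s, ∀ b ∈ s, a ≤ b → (F b - F a).PosSemidef) {t : ℝ} (ht : t ∈ s)
    (hs : UniqueDiffWithinAt ℝ s t) (hA : HasDerivWithinAt F A s t) : A.PosSemidef := by
  have := Fintype.ofFinite n
  have : (𝓝[s \ {t}] t).NeBot := accPt_principal_iff_nhdsWithin.1 hs.accPt
  refine isClosed_setOf_posSemidef.mem_of_tendsto (hasDerivWithinAt_iff_tendsto_slope.1 hA) ?_
  filter_upwards [self_mem_nhdsWithin] with r hr
  rcases le_total t r with h | h
  · exact (hF t ht r hr.1 h).smul (inv_nonneg.2 (sub_nonneg.2 h))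
  · rw [slope_comm]
    exact (hF r hr.1 t ht h).smul (inv_nonneg.2 (sub_nonneg.2 h))

end PosSemidef

section Calculus

variable {E : Type*} [NormedAddCommGroup E] [NormedSpace ℝ E]

lemma nonneg_of_hasDerivAt_of_le {f : ℝ → ℝ} {f' : ℝ} (hf : HasDerivAt f f' 0)
    (hmin : ∀ ε ∈ Icc (0 : ℝ) 1, f 0 ≤ f ε) : 0 ≤ f' := by
  refine ge_of_tendsto hf.tendsto_slope_zero_right ?_
  filter_upwards [Ioo_mem_nhdsGT one_pos] with ε hε
  rw [zero_add]
  exact smul_nonneg (inv_nonneg.2 hε.1.le) (sub_nonneg.2 (hmin ε ⟨hε.1.le, hε.2.le⟩))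

lemma tendsto_inv_smul_of_hasDerivWithinAt {f : ℝ → E} {f' : E} {b : ℝ} (hb : 0 < b)
    (hf : HasDerivWithinAt f f' (Icc 0 b) 0) (hf0 : f 0 = 0) :
    Tendsto (fun t : ℝ => t⁻¹ • f t) (𝓝[>] 0) (𝓝 f') := by
  have hslope := (hasDerivWithinAt_iff_tendsto_slope' self_notMem_Ioi).1
    (hf.mono_of_mem_nhdsWithin (Icc_mem_nhdsGT hb))
  simpa only [slope_fun_def, hf0, sub_zero, vsub_eq_sub] using hslope

lemma hasDerivWithinAt_add_smul (u v : E) (s : Set ℝ) :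
    HasDerivWithinAt (fun ε : ℝ => u + ε • v) v s 0 := by
  simpa only [id_eq, one_smul] using
    (((hasDerivAt_id (0 : ℝ)).smul_const v).const_add u).hasDerivWithinAt

lemma eventually_forall_mem_and_abs_fderiv_le {f : E → ℝ} {U : Set E} (hU : IsOpen U)
    (hf : ContDiffOn ℝ 1 f U) {K : Set (E × E)} (hK : IsCompact K) (hKU : ∀ p ∈ K, p.1 ∈ U) :
    ∃ C, ∀ᶠ ε : ℝ in 𝓝 0, ∀ p ∈ K, p.1 + ε • p.2 ∈ U ∧ |fderiv ℝ f (p.1 + ε • p.2) p.2| ≤ C := by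
  have line : Continuous fun z : ℝ × E × E => z.2.1 + z.1 • z.2.2 := by fun_prop
  have fderiv_line (p) (hp : p ∈ K) :
      ContinuousAt (fun z : ℝ × E × E => fderiv ℝ f (z.2.1 + z.1 • z.2.2) z.2.2) (0, p) := by
    refine ContinuousAt.clm_apply ?_ (by fun_prop)
    refine ContinuousAt.comp_of_eq ?_ line.continuousAt (by simp : _ = p.1)
    exact (hf.continuousOn_fderiv_of_isOpen hU le_rfl).continuousAt (hU.mem_nhds (hKU p hp))
  obtain ⟨C, hC⟩ := hK.exists_bound_of_continuousOn (f := fun p => fderiv ℝ f p.1 p.2)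
    fun p hp => by
      simpa [Function.comp_def] using
        ((fderiv_line p hp).comp (by fun_prop : ContinuousAt (fun q : E × E => ((0 : ℝ), q)) p)
          ).continuousWithinAt
  refine ⟨C + 1, hK.eventually_forall_of_forall_eventually fun p hp => ?_⟩
  refine (line.continuousAt.eventually (hU.mem_nhds (by simpa using hKU p hp))).and ?_
  refine ((fderiv_line p hp).abs.eventually_le_const ?_)
  have := hC p hp
  simp only [zero_smul, add_zero]
  rw [← Real.norm_eq_abs]
  linarith

lemma hasDerivAt_integral_mul_comp_line {f : E → ℝ} {U : Set E} (hU : IsOpen U)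
    (hf : ContDiffOn ℝ 1 f U) {a b : ℝ} (hab : a ≤ b) {w : ℝ → ℝ}
    (hw : IntervalIntegrable w volume a b) {u v : ℝ → E} (hu : ContinuousOn u (Icc a b))
    (hv : ContinuousOn v (Icc a b)) (huU : ∀ t ∈ Icc a b, u t ∈ U) {D : ℝ → ℝ}
    (hD : ∀ t ∈ Icc a b, HasDerivAt (fun ε : ℝ => f (u t + ε • v t)) (D t) 0) :
    HasDerivAt (fun ε : ℝ => ∫ t in a..b, w t * f (u t + ε • v t))
      (∫ t in a..b, w t * D t) 0 := by
  obtain ⟨C, hC⟩ := eventually_forall_mem_and_abs_fderiv_le hU hf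
    (isCompact_Icc.image_of_continuousOn (hu.prodMk hv))
    (by rintro _ ⟨t, ht, rfl⟩; exact huU t ht)
  simp only [forall_mem_image] at hC
  have mem_Icc {t : ℝ} (ht : t ∈ uIoc a b) : t ∈ Icc a b :=
    Ioc_subset_Icc_self (uIoc_of_le hab ▸ ht)
  have hasDerivAt_line {ε t : ℝ} (hmem : u t + ε • v t ∈ U) :
      HasDerivAt (fun ε : ℝ => f (u t + ε • v t)) (fderiv ℝ f (u t + ε • v t) (v t)) ε :=
    ((hf.differentiableOn one_ne_zero).differentiableAt (hU.mem_nhds hmem)).hasFDerivAt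
      |>.comp_hasDerivAt ε (by simpa using ((hasDerivAt_id ε).smul_const (v t)).const_add (u t))
  have fderiv_eq {t : ℝ} (ht : t ∈ Icc a b) : fderiv ℝ f (u t + (0 : ℝ) • v t) (v t) = D t :=
    (hasDerivAt_line (by simpa using huU t ht)).unique (hD t ht)
  have integrable {g : ℝ → ℝ} (hg : ContinuousOn g (Icc a b)) :
      IntervalIntegrable (fun t => w t * g t) volume a b :=
    hw.mul_continuousOn (by rwa [uIcc_of_le hab])
  have integrable_line {ε : ℝ} (hε : ∀ t ∈ Icc a b, u t + ε • v t ∈ U) :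
      IntervalIntegrable (fun t => w t * f (u t + ε • v t)) volume a b :=
    integrable (hf.continuousOn.comp (hu.add (hv.const_smul ε)) hε)
  have integrable_deriv : IntervalIntegrable
      (fun t => w t * fderiv ℝ f (u t + (0 : ℝ) • v t) (v t)) volume a b := by
    simp only [zero_smul, add_zero]
    exact integrable (((hf.continuousOn_fderiv_of_isOpen hU le_rfl).comp hu huU).clm_apply hv)
  have := (intervalIntegral.hasDerivAt_integral_of_dominated_loc_of_deriv_le
    (bound := fun t => |w t| * C) hC
    (hC.mono fun ε hε => (integrable_line fun t ht => (hε ht).1).def'.aestronglyMeasurable)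
    (integrable_line fun t ht => by simpa using huU t ht)
    integrable_deriv.def'.aestronglyMeasurable
    (ae_of_all _ fun t ht ε hε => by
      simpa only [norm_mul, Real.norm_eq_abs] using
        mul_le_mul_of_nonneg_left (hε (mem_Icc ht)).2 (abs_nonneg (w t)))
    (hw.abs.mul_const C)
    (ae_of_all _ fun t ht ε hε => (hasDerivAt_line (hε (mem_Icc ht)).1).const_mul (w t))).2
  rwa [intervalIntegral.integral_congr (g := fun t => w t * D t) fun t ht => by
    rw [uIcc_of_le hab] at ht
    simp only [fderiv_eq ht]] at this

lemma integral_add_smul_sub {F G : ℝ → E} {a b : ℝ} (hF : IntervalIntegrable F volume a b)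
    (hG : IntervalIntegrable G volume a b) (ε : ℝ) :
    ∫ t in a..b, (F t + ε • (G t - F t))
      = (∫ t in a..b, F t) + ε • ((∫ t in a..b, G t) - ∫ t in a..b, F t) := by
  rw [← intervalIntegral.integral_sub hG hF, ← intervalIntegral.integral_smul]
  exact intervalIntegral.integral_add hF ((hG.sub hF).smul ε)

lemma hasDerivWithinAt_integral [CompleteSpace E] {g : ℝ → E} {a b t : ℝ}
    (hg : ContinuousOn g (Icc a b)) (ht : t ∈ Icc a b) :
    HasDerivWithinAt (fun u => ∫ s in a..u, g s) (g t) (Icc a b) t :=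
  have := Fact.mk ht
  intervalIntegral.integral_hasDerivWithinAt_right
    ((hg.mono (Icc_subset_Icc_right ht.2)).intervalIntegrable_of_Icc ht.1)
    (hg.stronglyMeasurableAtFilter_nhdsWithin measurableSet_Icc t) (hg t ht)

lemma tendsto_integral_div_sq {a : ℝ → ℝ} {T γ : ℝ} (hT : 0 < T) (ha : ContinuousOn a (Icc 0 T))
    (hlim : Tendsto (fun t => a t / t) (𝓝[>] 0) (𝓝 γ)) :
    Tendsto (fun q => (∫ t in (0 : ℝ)..q, a t) / q ^ 2) (𝓝[>] 0) (𝓝 (γ / 2)) := by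
  have primitive := fun {q} (hq : q ∈ Icc 0 T) => hasDerivWithinAt_integral ha hq
  refine HasDerivAt.lhopital_zero_nhdsGT (f' := a) (g' := fun q => 2 * q) ?_ ?_ ?_ ?_ ?_ ?_
  · filter_upwards [Ioo_mem_nhdsGT hT] with q hq
    exact (primitive (Ioo_subset_Icc_self hq)).hasDerivAt (Icc_mem_nhds hq.1 hq.2)
  · exact .of_forall fun q => by simpa using hasDerivAt_pow 2 q
  · filter_upwards [self_mem_nhdsWithin] with q hq using mul_ne_zero two_ne_zero (ne_of_gt hq)
  · have := (primitive (left_mem_Icc.2 hT.le)).continuousWithinAt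
    rw [ContinuousWithinAt, intervalIntegral.integral_same] at this
    exact this.mono_left (nhdsWithin_le_of_mem (Icc_mem_nhdsGT hT))
  · exact ((continuous_pow 2).tendsto' 0 0 (by norm_num)).mono_left nhdsWithin_le_nhds
  · simpa only [div_div, mul_comm (2 : ℝ)] using hlim.div_const 2

end Calculus

variable {m : ℕ}

section MatrixCalculus

variable {U V : Matrix (Fin m) (Fin m) ℝ}

lemma pairing_add_left (A B C : Matrix (Fin m) (Fin m) ℝ) :
    pairing (A + B) C = pairing A C + pairing B C := by
  simp only [pairing, add_mul, Matrix.trace_add]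

lemma pairing_sub_left (A B C : Matrix (Fin m) (Fin m) ℝ) :
    pairing (A - B) C = pairing A C - pairing B C := by
  simp only [pairing, sub_mul, Matrix.trace_sub]

lemma pairing_sub_right (A B C : Matrix (Fin m) (Fin m) ℝ) :
    pairing A (B - C) = pairing A B - pairing A C := by
  simp only [pairing, mul_sub, Matrix.trace_sub]

lemma pairing_smul_left (c : ℝ) (A B : Matrix (Fin m) (Fin m) ℝ) :
    pairing (c • A) B = c * pairing A B := by
  simp only [pairing, Matrix.smul_mul, Matrix.trace_smul, smul_eq_mul]

lemma pairing_smul_right (c : ℝ) (A B : Matrix (Fin m) (Fin m) ℝ) :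
    pairing A (c • B) = c * pairing A B := by
  simp only [pairing, Matrix.mul_smul, Matrix.trace_smul, smul_eq_mul]

lemma pairing_zero_left (A : Matrix (Fin m) (Fin m) ℝ) : pairing 0 A = 0 := by
  simp only [pairing, zero_mul, Matrix.trace_zero]

lemma pairing_zero_right (A : Matrix (Fin m) (Fin m) ℝ) : pairing A 0 = 0 := by
  simp only [pairing, mul_zero, Matrix.trace_zero]

lemma pairing_vecMulVec_nonneg (hU : U.PosSemidef) (h : Fin m → ℝ) :
    0 ≤ pairing (Matrix.vecMulVec h h) U := by
  rw [pairing, Matrix.vecMulVec_mul, Matrix.trace_vecMulVec, dotProduct_comm,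
    ← Matrix.dotProduct_mulVec]
  exact hU.dotProduct_mulVec_nonneg h

lemma continuousOn_pairing {X : Type*} [TopologicalSpace X] {s : Set X}
    {F G : X → Matrix (Fin m) (Fin m) ℝ} (hF : ContinuousOn F s) (hG : ContinuousOn G s) :
    ContinuousOn (fun t => pairing (F t) (G t)) s :=
  continuous_id.matrix_trace.comp_continuousOn (hF.mul hG)

lemma tendsto_pairing {ι : Type*} {l : Filter ι} {F G : ι → Matrix (Fin m) (Fin m) ℝ}
    (hF : Tendsto F l (𝓝 U)) (hG : Tendsto G l (𝓝 V)) :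
    Tendsto (fun i => pairing (F i) (G i)) l (𝓝 (pairing U V)) :=
  (continuous_id.matrix_trace.tendsto _).comp (hF.mul hG)

lemma hasDerivWithinAt_matrix_iff {F : ℝ → Matrix (Fin m) (Fin m) ℝ} {s : Set ℝ} {t : ℝ} :
    HasDerivWithinAt F U s t ↔
      ∀ i j, HasDerivWithinAt (fun r => F r i j) (U i j) s t :=
  hasDerivWithinAt_pi.trans (forall_congr' fun _ => hasDerivWithinAt_pi)

lemma hasDerivWithinAt_trace {F : ℝ → Matrix (Fin m) (Fin m) ℝ} {s : Set ℝ} {t : ℝ}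
    (hF : HasDerivWithinAt F U s t) :
    HasDerivWithinAt (fun r => (F r).trace) U.trace s t :=
  HasDerivWithinAt.fun_sum fun i _ => hasDerivWithinAt_matrix_iff.1 hF i i

lemma hasDerivWithinAt_pairing {F G : ℝ → Matrix (Fin m) (Fin m) ℝ} {s : Set ℝ} {t : ℝ}
    (hF : HasDerivWithinAt F U s t) (hG : HasDerivWithinAt G V s t) :
    HasDerivWithinAt (fun r => pairing (F r) (G r)) (pairing U (G t) + pairing (F t) V) s t := by
  simp only [pairing, ← Matrix.trace_add]
  exact hasDerivWithinAt_trace (hF.mul hG)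

lemma contDiffAt_matrix_inv (hU : U.det ≠ 0) :
    ContDiffAt ℝ 1 (fun A : Matrix (Fin m) (Fin m) ℝ => A⁻¹) U := by
  obtain ⟨u, rfl⟩ := (Matrix.isUnit_iff_isUnit_det U).2 hU.isUnit
  simp only [Matrix.nonsing_inv_eq_ringInverse]
  exact contDiffAt_ringInverse ℝ u

lemma continuousOn_matrix_inv {X : Type*} [TopologicalSpace X] {s : Set X}
    {F : X → Matrix (Fin m) (Fin m) ℝ} (hF : ContinuousOn F s) (hdet : ∀ t ∈ s, (F t).det ≠ 0) :
    ContinuousOn (fun t => (F t)⁻¹) s := fun t ht =>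
  (contDiffAt_matrix_inv (hdet t ht)).continuousAt.comp_continuousWithinAt (hF t ht)

lemma hasDerivWithinAt_matrix_inv {F : ℝ → Matrix (Fin m) (Fin m) ℝ} {s : Set ℝ} {t : ℝ}
    (hF : HasDerivWithinAt F U s t) (hdet : (F t).det ≠ 0) :
    HasDerivWithinAt (fun r => (F r)⁻¹) (-((F t)⁻¹ * U * (F t)⁻¹)) s t := by
  obtain ⟨u, hu⟩ := (Matrix.isUnit_iff_isUnit_det _).2 hdet.isUnit
  have := (hu ▸ hasFDerivAt_ringInverse u : HasFDerivAt _ _ (F t)).comp_hasDerivWithinAt t hF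
  simp only [Matrix.nonsing_inv_eq_ringInverse, ← hu, Ring.inverse_unit]
  exact this

lemma isOpen_setOf_det_fst_ne_zero :
    IsOpen {p : Matrix (Fin m) (Fin m) ℝ × Matrix (Fin m) (Fin m) ℝ | p.1.det ≠ 0} :=
  isOpen_ne.preimage continuous_fst.matrix_det

lemma contDiffOn_pairing_inv :
    ContDiffOn ℝ 1 (fun p : Matrix (Fin m) (Fin m) ℝ × Matrix (Fin m) (Fin m) ℝ =>
      pairing p.1⁻¹ p.2) {p | p.1.det ≠ 0} := fun p hp =>
  ((Matrix.traceLinearMap (Fin m) ℝ ℝ).toContinuousLinearMap.contDiff.contDiffAt.comp p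
    (((contDiffAt_matrix_inv hp).comp p contDiffAt_fst).mul contDiffAt_snd)).contDiffWithinAt

end MatrixCalculus

section OrderParameter

variable {x y : ℝ → ℝ} {t : ℝ}

lemma zero_mem_timeInterval : (0 : ℝ) ∈ Icc 0 (m : ℝ) := left_mem_Icc.2 m.cast_nonneg

lemma end_mem_timeInterval : (m : ℝ) ∈ Icc 0 (m : ℝ) := right_mem_Icc.2 m.cast_nonneg

lemma topPoint_le (ht : t ∈ Icc 0 (m : ℝ)) (h : x t = 1) : topPoint m x ≤ t :=
  csInf_le ⟨0, fun _ hs => hs.1.1⟩ ⟨ht, h⟩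

namespace IsOrderParameter

lemma topPoint_mem (hx : IsOrderParameter m x) : topPoint m x ∈ Icc 0 (m : ℝ) :=
  ⟨le_csInf ⟨m, end_mem_timeInterval, hx.right_end⟩ fun _ hs => hs.1.1,
    topPoint_le end_mem_timeInterval hx.right_end⟩

lemma le_one (hx : IsOrderParameter m x) (ht : t ∈ Icc 0 (m : ℝ)) : x t ≤ 1 :=
  hx.right_end ▸ hx.monotoneOn ht end_mem_timeInterval ht.2

lemma eq_one_of_topPoint_lt (hx : IsOrderParameter m x) (ht : topPoint m x < t) (htm : t ≤ m) :
    x t = 1 := by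
  have ht' : t ∈ Icc 0 (m : ℝ) := ⟨hx.topPoint_mem.1.trans ht.le, htm⟩
  have hne : {s | s ∈ Icc 0 (m : ℝ) ∧ x s = 1}.Nonempty :=
    ⟨m, end_mem_timeInterval, hx.right_end⟩
  obtain ⟨s, ⟨hs, hxs⟩, hst⟩ := exists_lt_of_csInf_lt hne ht
  exact le_antisymm (hx.le_one ht') (hxs ▸ hx.monotoneOn hs ht' hst.le)

lemma apply_topPoint (hx : IsOrderParameter m x) : x (topPoint m x) = 1 := by
  rcases hx.topPoint_mem.2.eq_or_lt with h | h
  · rw [h, hx.right_end]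
  refine tendsto_nhds_unique
    ((hx.rightContinuous _ ⟨hx.topPoint_mem.1, h⟩).mono Ioi_subset_Ici_self)
    (tendsto_const_nhds.congr' ?_)
  filter_upwards [Ioo_mem_nhdsGT h] with t ht using (hx.eq_one_of_topPoint_lt ht.1 ht.2.le).symm

lemma eq_one_of_topPoint_le (hx : IsOrderParameter m x) (ht : topPoint m x ≤ t) (htm : t ≤ m) :
    x t = 1 := by
  rcases ht.eq_or_lt with rfl | ht
  exacts [hx.apply_topPoint, hx.eq_one_of_topPoint_lt ht htm]

lemma intervalIntegrable (hx : IsOrderParameter m x) {a b : ℝ} (ha : a ∈ Icc 0 (m : ℝ))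
    (hb : b ∈ Icc 0 (m : ℝ)) : IntervalIntegrable x volume a b :=
  (hx.monotoneOn.mono (uIcc_subset_Icc ha hb)).intervalIntegrable

lemma add_smul_sub (hx : IsOrderParameter m x) (hy : IsOrderParameter m y) {ε : ℝ}
    (hε : ε ∈ Icc (0 : ℝ) 1) : IsOrderParameter m (x + ε • (y - x)) where
  monotoneOn a ha b hb hab := by
    have hxab := mul_le_mul_of_nonneg_left (hx.monotoneOn ha hb hab) (sub_nonneg.2 hε.2)
    have hyab := mul_le_mul_of_nonneg_left (hy.monotoneOn ha hb hab) hε.1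
    simp only [Pi.add_apply, Pi.smul_apply, Pi.sub_apply, smul_eq_mul]
    linarith
  rightContinuous t ht :=
    (hx.rightContinuous t ht).add
      (((hy.rightContinuous t ht).sub (hx.rightContinuous t ht)).const_smul ε)
  nonneg t ht := by
    have hxt := mul_nonneg (sub_nonneg.2 hε.2) (hx.nonneg t ht)
    have hyt := mul_nonneg hε.1 (hy.nonneg t ht)
    simp only [Pi.add_apply, Pi.smul_apply, Pi.sub_apply, smul_eq_mul]
    linarith
  right_end := by simp [hx.right_end, hy.right_end]

end IsOrderParameter

end OrderParameter

/-- Differentiable monotone paths, without any normalization of the trace. -/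
structure IsDifferentiablePath (Q : Matrix (Fin m) (Fin m) ℝ)
    (Φ : ℝ → Matrix (Fin m) (Fin m) ℝ) : Prop extends IsMonotonePath Q Φ where
  differentiableOn : DifferentiableOn ℝ Φ (Icc 0 (m : ℝ))

/-- Continuously differentiable monotone paths, without any normalization of the trace. -/
structure IsC1Path (Q : Matrix (Fin m) (Fin m) ℝ)
    (Φ : ℝ → Matrix (Fin m) (Fin m) ℝ) : Prop extends IsDifferentiablePath Q Φ where
  continuousOn_pathDeriv : ContinuousOn (pathDeriv Φ) (Icc 0 (m : ℝ))

section Path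

variable {Q : Matrix (Fin m) (Fin m) ℝ} {Φ Ψ : ℝ → Matrix (Fin m) (Fin m) ℝ} {s t : ℝ}

lemma pathDeriv_eq_of_hasDerivWithinAt {D : Matrix (Fin m) (Fin m) ℝ} (ht : t ∈ Icc 0 (m : ℝ))
    (hD : HasDerivWithinAt Φ D (Icc 0 (m : ℝ)) t) : pathDeriv Φ t = D := by
  obtain rfl | hm := m.eq_zero_or_pos
  · exact Subsingleton.elim _ _
  ext i j
  exact (hasDerivWithinAt_matrix_iff.1 hD i j).derivWithin
    (uniqueDiffOn_Icc (Nat.cast_pos.2 hm) t ht)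

lemma hasDerivWithinAt_pathDeriv
    (hΦ : ∀ i j, DifferentiableWithinAt ℝ (fun s => Φ s i j) (Icc 0 (m : ℝ)) t) :
    HasDerivWithinAt Φ (pathDeriv Φ t) (Icc 0 (m : ℝ)) t :=
  hasDerivWithinAt_matrix_iff.2 fun i j => (hΦ i j).hasDerivWithinAt

namespace IsMonotonePath

lemma monotoneOn_trace (hΦ : IsMonotonePath Q Φ) :
    MonotoneOn (fun t => (Φ t).trace) (Icc 0 (m : ℝ)) := fun a ha b hb hab =>
  sub_nonneg.1 (Matrix.trace_sub (Φ b) (Φ a) ▸ (hΦ.monotone a ha b hb hab).trace_nonneg)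

lemma abs_sub_le (hΦ : IsMonotonePath Q Φ) (hs : s ∈ Icc 0 (m : ℝ)) (ht : t ∈ Icc 0 (m : ℝ))
    (i j : Fin m) : |Φ t i j - Φ s i j| ≤ |(Φ t).trace - (Φ s).trace| := by
  wlog hst : s ≤ t generalizing s t
  · rw [abs_sub_comm, abs_sub_comm (Φ t).trace]
    exact this ht hs (le_of_not_ge hst)
  rw [← Matrix.trace_sub]
  exact (abs_apply_le_trace (hΦ.monotone s hs t ht hst) i j).trans (le_abs_self _)

lemma eq_of_trace_eq (hΦ : IsMonotonePath Q Φ) (hs : s ∈ Icc 0 (m : ℝ))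
    (ht : t ∈ Icc 0 (m : ℝ)) (h : (Φ s).trace = (Φ t).trace) : Φ s = Φ t := by
  ext i j
  have := hΦ.abs_sub_le ht hs i j
  rw [h, sub_self, abs_zero] at this
  exact sub_eq_zero.1 (abs_nonpos_iff.1 this)

lemma posSemidef_sub (hΦ : IsMonotonePath Q Φ) (ht : t ∈ Icc 0 (m : ℝ)) :
    (Q - Φ t).PosSemidef :=
  hΦ.right_end ▸ hΦ.monotone t ht m end_mem_timeInterval ht.2

lemma add_smul_sub (hΦ : IsMonotonePath Q Φ) (hΨ : IsMonotonePath Q Ψ) {ε : ℝ}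
    (hε : ε ∈ Icc (0 : ℝ) 1) : IsMonotonePath Q (Φ + ε • (Ψ - Φ)) := by
  have convex {A B : Matrix (Fin m) (Fin m) ℝ} (hA : A.PosSemidef) (hB : B.PosSemidef) :
      (A + ε • (B - A)).PosSemidef := by
    convert (hA.smul (sub_nonneg.2 hε.2)).add (hB.smul hε.1) using 1
    module
  refine ⟨fun t ht => convex (hΦ.posSemidef t ht) (hΨ.posSemidef t ht), fun s hs t ht hst => ?_,
    ?_, ?_⟩
  · convert convex (hΦ.monotone s hs t ht hst) (hΨ.monotone s hs t ht hst) using 1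
    simp only [Pi.add_apply, Pi.smul_apply, Pi.sub_apply]
    module
  · simp [hΦ.left_end, hΨ.left_end]
  · simp [hΦ.right_end, hΨ.right_end]

end IsMonotonePath

namespace IsDifferentiablePath

lemma hasDerivWithinAt (hΦ : IsDifferentiablePath Q Φ) (ht : t ∈ Icc 0 (m : ℝ)) :
    HasDerivWithinAt Φ (pathDeriv Φ t) (Icc 0 (m : ℝ)) t :=
  hasDerivWithinAt_pathDeriv fun i j =>
    (hasDerivWithinAt_matrix_iff.1 (hΦ.differentiableOn t ht).hasDerivWithinAt i j
      ).differentiableWithinAt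

lemma continuousOn (hΦ : IsDifferentiablePath Q Φ) : ContinuousOn Φ (Icc 0 (m : ℝ)) :=
  hΦ.differentiableOn.continuousOn

lemma posSemidef_pathDeriv (hΦ : IsDifferentiablePath Q Φ) (ht : t ∈ Icc 0 (m : ℝ)) :
    (pathDeriv Φ t).PosSemidef := by
  obtain rfl | hm := m.eq_zero_or_pos
  · exact Subsingleton.elim 0 (pathDeriv Φ t) ▸ .zero
  exact posSemidef_of_hasDerivWithinAt hΦ.monotone ht
    (uniqueDiffOn_Icc (Nat.cast_pos.2 hm) t ht) (hΦ.hasDerivWithinAt ht)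

lemma hasDerivWithinAt_add_smul_sub (hΦ : IsDifferentiablePath Q Φ)
    (hΨ : IsDifferentiablePath Q Ψ) (ε : ℝ) (ht : t ∈ Icc 0 (m : ℝ)) :
    HasDerivWithinAt (Φ + ε • (Ψ - Φ)) (pathDeriv Φ t + ε • (pathDeriv Ψ t - pathDeriv Φ t))
      (Icc 0 (m : ℝ)) t :=
  (hΦ.hasDerivWithinAt ht).add
    (((hΨ.hasDerivWithinAt ht).sub (hΦ.hasDerivWithinAt ht)).const_smul ε)

lemma pathDeriv_add_smul_sub (hΦ : IsDifferentiablePath Q Φ) (hΨ : IsDifferentiablePath Q Ψ)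
    (ε : ℝ) (ht : t ∈ Icc 0 (m : ℝ)) :
    pathDeriv (Φ + ε • (Ψ - Φ)) t = pathDeriv Φ t + ε • (pathDeriv Ψ t - pathDeriv Φ t) :=
  pathDeriv_eq_of_hasDerivWithinAt ht (hΦ.hasDerivWithinAt_add_smul_sub hΨ ε ht)

lemma add_smul_sub (hΦ : IsDifferentiablePath Q Φ) (hΨ : IsDifferentiablePath Q Ψ) {ε : ℝ}
    (hε : ε ∈ Icc (0 : ℝ) 1) : IsDifferentiablePath Q (Φ + ε • (Ψ - Φ)) where
  toIsMonotonePath := hΦ.toIsMonotonePath.add_smul_sub hΨ.toIsMonotonePath hε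
  differentiableOn _ ht := (hΦ.hasDerivWithinAt_add_smul_sub hΨ ε ht).differentiableWithinAt

lemma eqOn_pathDeriv (hΦ : IsDifferentiablePath Q Φ) (hΨ : IsDifferentiablePath Q Ψ) {T : ℝ}
    (hT : T ∈ Ico 0 (m : ℝ)) (h : EqOn Ψ Φ (Icc T m)) :
    EqOn (pathDeriv Ψ) (pathDeriv Φ) (Icc T m) := fun _ ht =>
  have hsub := Icc_subset_Icc_left hT.1
  (uniqueDiffOn_Icc hT.2 _ ht).eq_deriv _ ((hΨ.hasDerivWithinAt (hsub ht)).mono hsub)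
    (((hΦ.hasDerivWithinAt (hsub ht)).mono hsub).congr h (h ht))

end IsDifferentiablePath

end Path

/-- The right-continuous inverse of the trace of a path. Composing with it normalizes the trace,
at the price of the differentiability of the path. -/
def traceInv (Φ : ℝ → Matrix (Fin m) (Fin m) ℝ) (s : ℝ) : ℝ :=
  sSup {t | t ∈ Icc 0 (m : ℝ) ∧ (Φ t).trace ≤ s}

section Reparametrization

variable {Q : Matrix (Fin m) (Fin m) ℝ} {Φ : ℝ → Matrix (Fin m) (Fin m) ℝ} {x : ℝ → ℝ}
  {a b s t : ℝ}

lemma IsMonotonePath.trace_mem (hQ : Q.trace = m) (hΦ : IsMonotonePath Q Φ)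
    (ht : t ∈ Icc 0 (m : ℝ)) : (Φ t).trace ∈ Icc 0 (m : ℝ) := by
  refine ⟨(hΦ.posSemidef t ht).trace_nonneg, ?_⟩
  simpa only [hΦ.right_end, hQ] using hΦ.monotoneOn_trace ht end_mem_timeInterval ht.2

lemma IsMonotonePath.traceInv_mem (hΦ : IsMonotonePath Q Φ) (hs : s ∈ Icc 0 (m : ℝ)) :
    traceInv Φ s ∈ Icc 0 (m : ℝ) := by
  have h0 : (0 : ℝ) ∈ {t | t ∈ Icc 0 (m : ℝ) ∧ (Φ t).trace ≤ s} :=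
    ⟨zero_mem_timeInterval, by simpa only [hΦ.left_end, Matrix.trace_zero] using hs.1⟩
  exact ⟨le_csSup ⟨m, fun _ ht => ht.1.2⟩ h0, csSup_le ⟨0, h0⟩ fun _ ht => ht.1.2⟩

namespace IsDifferentiablePath

lemma continuousOn_trace (hΦ : IsDifferentiablePath Q Φ) :
    ContinuousOn (fun t => (Φ t).trace) (Icc 0 (m : ℝ)) := fun _ ht =>
  (hasDerivWithinAt_trace (hΦ.hasDerivWithinAt ht)).continuousWithinAt

lemma hasDerivAt_trace (hΦ : IsDifferentiablePath Q Φ) (ht : t ∈ Ioo 0 (m : ℝ)) :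
    HasDerivAt (fun s => (Φ s).trace) (pathDeriv Φ t).trace t :=
  (hasDerivWithinAt_trace (hΦ.hasDerivWithinAt (Ioo_subset_Icc_self ht))).hasDerivAt
    (Icc_mem_nhds ht.1 ht.2)

lemma trace_traceInv (hQ : Q.trace = m) (hΦ : IsDifferentiablePath Q Φ)
    (hs : s ∈ Icc 0 (m : ℝ)) : (Φ (traceInv Φ s)).trace = s := by
  have hs' : s ∈ Icc (Φ 0).trace (Φ m).trace := by
    simpa only [hΦ.left_end, hΦ.right_end, hQ, Matrix.trace_zero] using hs
  obtain ⟨t, ht, rfl⟩ := intermediate_value_Icc m.cast_nonneg hΦ.continuousOn_trace hs'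
  have hclosed : IsClosed {r | r ∈ Icc 0 (m : ℝ) ∧ (Φ r).trace ≤ (Φ t).trace} :=
    hΦ.continuousOn_trace.preimage_isClosed_of_isClosed isClosed_Icc isClosed_Iic
  have hbdd : BddAbove {r | r ∈ Icc 0 (m : ℝ) ∧ (Φ r).trace ≤ (Φ t).trace} :=
    ⟨m, fun _ hr => hr.1.2⟩
  exact le_antisymm (hclosed.csSup_mem ⟨t, ht, le_rfl⟩ hbdd).2
    (hΦ.monotoneOn_trace ht (hΦ.traceInv_mem hs) (le_csSup hbdd ⟨ht, le_rfl⟩))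

lemma le_traceInv_iff (hQ : Q.trace = m) (hΦ : IsDifferentiablePath Q Φ)
    (hs : s ∈ Icc 0 (m : ℝ)) (ht : t ∈ Icc 0 (m : ℝ)) :
    t ≤ traceInv Φ s ↔ (Φ t).trace ≤ s :=
  ⟨fun h => (hΦ.monotoneOn_trace ht (hΦ.traceInv_mem hs) h).trans_eq (hΦ.trace_traceInv hQ hs),
    fun h => le_csSup ⟨m, fun _ hr => hr.1.2⟩ ⟨ht, h⟩⟩

lemma traceInv_lt_iff (hQ : Q.trace = m) (hΦ : IsDifferentiablePath Q Φ)
    (hs : s ∈ Icc 0 (m : ℝ)) (ht : t ∈ Icc 0 (m : ℝ)) :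
    traceInv Φ s < t ↔ s < (Φ t).trace :=
  lt_iff_lt_of_le_iff_le (hΦ.le_traceInv_iff hQ hs ht)

lemma apply_traceInv_trace (hQ : Q.trace = m) (hΦ : IsDifferentiablePath Q Φ)
    (ht : t ∈ Icc 0 (m : ℝ)) : Φ (traceInv Φ (Φ t).trace) = Φ t :=
  hΦ.eq_of_trace_eq (hΦ.traceInv_mem (hΦ.trace_mem hQ ht)) ht
    (hΦ.trace_traceInv hQ (hΦ.trace_mem hQ ht))

lemma monotoneOn_traceInv (hQ : Q.trace = m) (hΦ : IsDifferentiablePath Q Φ) :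
    MonotoneOn (traceInv Φ) (Icc 0 (m : ℝ)) := fun _ ha _ hb hab =>
  (hΦ.le_traceInv_iff hQ hb (hΦ.traceInv_mem ha)).2 ((hΦ.trace_traceInv hQ ha).trans_le hab)

lemma traceInv_right_end (hQ : Q.trace = m) (hΦ : IsDifferentiablePath Q Φ) :
    traceInv Φ m = m :=
  le_antisymm (hΦ.traceInv_mem end_mem_timeInterval).2
    ((hΦ.le_traceInv_iff hQ end_mem_timeInterval end_mem_timeInterval).2
      (by rw [hΦ.right_end, hQ]))

lemma traceInv_lt_right_end (hQ : Q.trace = m) (hΦ : IsDifferentiablePath Q Φ)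
    (hs : s ∈ Ico 0 (m : ℝ)) : traceInv Φ s < m :=
  (hΦ.traceInv_lt_iff hQ (Ico_subset_Icc_self hs) end_mem_timeInterval).2
    (by rw [hΦ.right_end, hQ]; exact hs.2)

lemma eventually_traceInv_lt (hQ : Q.trace = m) (hΦ : IsDifferentiablePath Q Φ)
    (hs : s ∈ Icc 0 (m : ℝ)) (hb : traceInv Φ s < b) :
    ∀ᶠ u in 𝓝[Icc 0 (m : ℝ)] s, traceInv Φ u < b := by
  rcases le_or_gt b m with hbm | hbm
  · have hb' : b ∈ Icc 0 (m : ℝ) := ⟨(hΦ.traceInv_mem hs).1.trans hb.le, hbm⟩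
    filter_upwards [self_mem_nhdsWithin,
      mem_nhdsWithin_of_mem_nhds (Iio_mem_nhds ((hΦ.traceInv_lt_iff hQ hs hb').1 hb))] with u hu hub
    exact (hΦ.traceInv_lt_iff hQ hu hb').2 hub
  · filter_upwards [self_mem_nhdsWithin] with u hu using (hΦ.traceInv_mem hu).2.trans_lt hbm

lemma continuousWithinAt_Ici_traceInv (hQ : Q.trace = m) (hΦ : IsDifferentiablePath Q Φ)
    (hs : s ∈ Ico 0 (m : ℝ)) : ContinuousWithinAt (traceInv Φ) (Ico s m) s := by
  have hs' := Ico_subset_Icc_self hs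
  have hsub : Ico s (m : ℝ) ⊆ Icc 0 m := fun u hu => ⟨hs.1.trans hu.1, hu.2.le⟩
  refine tendsto_order.2 ⟨fun a ha => ?_, fun b hb => ?_⟩
  · filter_upwards [self_mem_nhdsWithin] with u hu
    exact ha.trans_le (hΦ.monotoneOn_traceInv hQ hs' (hsub hu) hu.1)
  · exact (hΦ.eventually_traceInv_lt hQ hs' hb).filter_mono (nhdsWithin_mono s hsub)

lemma isTracePath_comp_traceInv (hQ : Q.trace = m) (hΦ : IsDifferentiablePath Q Φ) :
    IsTracePath Q (Φ ∘ traceInv Φ) where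
  posSemidef s hs := hΦ.posSemidef _ (hΦ.traceInv_mem hs)
  monotone s hs t ht hst := hΦ.monotone _ (hΦ.traceInv_mem hs) _ (hΦ.traceInv_mem ht)
    (hΦ.monotoneOn_traceInv hQ hs ht hst)
  left_end := by
    have := hΦ.apply_traceInv_trace hQ zero_mem_timeInterval
    rwa [hΦ.left_end, Matrix.trace_zero] at this
  right_end := by rw [Function.comp_apply, hΦ.traceInv_right_end hQ, hΦ.right_end]
  lipschitz i j := LipschitzOnWith.of_dist_le_mul fun s hs t ht => by
    have := hΦ.abs_sub_le (hΦ.traceInv_mem ht) (hΦ.traceInv_mem hs) i j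
    rw [hΦ.trace_traceInv hQ hs, hΦ.trace_traceInv hQ ht] at this
    simpa only [Real.dist_eq, NNReal.coe_one, one_mul, Function.comp_apply] using this
  trace s hs := hΦ.trace_traceInv hQ hs

lemma isOrderParameter_comp_traceInv (hQ : Q.trace = m) (hΦ : IsDifferentiablePath Q Φ)
    (hx : IsOrderParameter m x) : IsOrderParameter m (x ∘ traceInv Φ) where
  monotoneOn s hs t ht hst := hx.monotoneOn (hΦ.traceInv_mem hs) (hΦ.traceInv_mem ht)
    (hΦ.monotoneOn_traceInv hQ hs ht hst)
  rightContinuous s hs := by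
    have hs' := Ico_subset_Icc_self hs
    refine ContinuousWithinAt.mono_of_mem_nhdsWithin ?_ (Ico_mem_nhdsGE hs.2)
    refine (hx.rightContinuous _ ⟨(hΦ.traceInv_mem hs').1, hΦ.traceInv_lt_right_end hQ hs⟩).comp
      (hΦ.continuousWithinAt_Ici_traceInv hQ hs) fun u hu => ?_
    exact hΦ.monotoneOn_traceInv hQ hs' ⟨hs.1.trans hu.1, hu.2.le⟩ hu.1
  nonneg s hs := hx.nonneg _ (hΦ.traceInv_mem hs)
  right_end := by rw [Function.comp_apply, hΦ.traceInv_right_end hQ, hx.right_end]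

lemma trace_lt_trace_of_pathDeriv_ne_zero (hΦ : IsDifferentiablePath Q Φ)
    (ha : a ∈ Icc 0 (m : ℝ)) (hb : b ∈ Icc 0 (m : ℝ)) (hab : a < b) (ht : t ∈ Icc a b)
    (hne : pathDeriv Φ t ≠ 0) : (Φ a).trace < (Φ b).trace := by
  have hsub : Icc a b ⊆ Icc 0 (m : ℝ) := Icc_subset_Icc ha.1 hb.2
  refine (hΦ.monotoneOn_trace ha hb hab.le).lt_of_ne fun htrace => hne ?_
  have hconst : ∀ r ∈ Icc a b, Φ r = Φ a := fun r hr =>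
    hΦ.eq_of_trace_eq (hsub hr) ha <| le_antisymm
      ((hΦ.monotoneOn_trace (hsub hr) hb hr.2).trans_eq htrace.symm)
      (hΦ.monotoneOn_trace ha (hsub hr) hr.1)
  ext i j
  exact (uniqueDiffOn_Icc hab t ht).eq_deriv _
    (hasDerivWithinAt_matrix_iff.1 ((hΦ.hasDerivWithinAt (hsub ht)).mono hsub) i j)
    ((hasDerivWithinAt_const t _ (Φ a i j)).congr (fun r hr => by rw [hconst r hr])
      (by rw [hconst t ht]))

lemma traceInv_trace (hQ : Q.trace = m) (hΦ : IsDifferentiablePath Q Φ)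
    (ht : t ∈ Icc 0 (m : ℝ)) (hne : pathDeriv Φ t ≠ 0) : traceInv Φ (Φ t).trace = t := by
  have hτ := hΦ.trace_mem hQ ht
  refine le_antisymm (not_lt.1 fun hlt => ?_) ((hΦ.le_traceInv_iff hQ hτ ht).2 le_rfl)
  have := hΦ.trace_lt_trace_of_pathDeriv_ne_zero ht (hΦ.traceInv_mem hτ) hlt
    (left_mem_Icc.2 hlt.le) hne
  exact this.ne' (hΦ.trace_traceInv hQ hτ)

lemma continuousAt_traceInv_trace (hQ : Q.trace = m) (hΦ : IsDifferentiablePath Q Φ)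
    (ht : t ∈ Icc 0 (m : ℝ)) (hne : pathDeriv Φ t ≠ 0) :
    ContinuousWithinAt (traceInv Φ) (Icc 0 (m : ℝ)) (Φ t).trace := by
  have hinv := hΦ.traceInv_trace hQ ht hne
  refine tendsto_order.2 ⟨fun a ha => ?_, fun b hb =>
    hΦ.eventually_traceInv_lt hQ (hΦ.trace_mem hQ ht) hb⟩
  rw [hinv] at ha
  rcases lt_or_ge a 0 with ha0 | ha0
  · filter_upwards [self_mem_nhdsWithin] with u hu using ha0.trans_le (hΦ.traceInv_mem hu).1
  obtain ⟨c, hac, hct⟩ := exists_between ha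
  have hc : c ∈ Icc 0 (m : ℝ) := ⟨ha0.trans hac.le, hct.le.trans ht.2⟩
  have htrace := hΦ.trace_lt_trace_of_pathDeriv_ne_zero hc ht hct (right_mem_Icc.2 hct.le) hne
  filter_upwards [self_mem_nhdsWithin, mem_nhdsWithin_of_mem_nhds (Ioi_mem_nhds htrace)]
    with u hu hcu
  exact hac.trans_le ((hΦ.le_traceInv_iff hQ hu hc).2 (le_of_lt hcu))

lemma pathDeriv_comp_traceInv (hQ : Q.trace = m) (hΦ : IsDifferentiablePath Q Φ)
    (ht : t ∈ Ioo 0 (m : ℝ)) (hne : pathDeriv Φ t ≠ 0) :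
    pathDeriv (Φ ∘ traceInv Φ) (Φ t).trace = (pathDeriv Φ t).trace⁻¹ • pathDeriv Φ t := by
  have ht' := Ioo_subset_Icc_self ht
  have hinv := hΦ.traceInv_trace hQ ht' hne
  have htrace_ne : (pathDeriv Φ t).trace ≠ 0 :=
    mt (hΦ.posSemidef_pathDeriv ht').trace_eq_zero_iff.1 hne
  have hpos : 0 < (Φ t).trace := by
    simpa only [hΦ.left_end, Matrix.trace_zero] using hΦ.trace_lt_trace_of_pathDeriv_ne_zero
      zero_mem_timeInterval ht' ht.1 (right_mem_Icc.2 ht.1.le) hne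
  have hlt : (Φ t).trace < m := by
    simpa only [hΦ.right_end, hQ] using hΦ.trace_lt_trace_of_pathDeriv_ne_zero
      ht' end_mem_timeInterval ht.2 (left_mem_Icc.2 ht.2.le) hne
  have hderiv_inv : HasDerivAt (traceInv Φ) (pathDeriv Φ t).trace⁻¹ (Φ t).trace := by
    refine HasDerivAt.of_local_left_inverse (f := fun s => (Φ s).trace)
      ((hΦ.continuousAt_traceInv_trace hQ ht' hne).continuousAt (Icc_mem_nhds hpos hlt))
      (by rw [hinv]; exact hΦ.hasDerivAt_trace ht) htrace_ne ?_
    filter_upwards [Ioo_mem_nhds hpos hlt] with u hu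
      using hΦ.trace_traceInv hQ (Ioo_subset_Icc_self hu)
  refine pathDeriv_eq_of_hasDerivWithinAt (hΦ.trace_mem hQ ht')
    (hasDerivWithinAt_matrix_iff.2 fun i j => ?_)
  have hentry : HasDerivAt (fun s => Φ s i j) (pathDeriv Φ t i j) (traceInv Φ (Φ t).trace) := by
    rw [hinv]
    exact (hasDerivWithinAt_matrix_iff.1 (hΦ.hasDerivWithinAt ht') i j).hasDerivAt
      (Icc_mem_nhds ht.1 ht.2)
  rw [Matrix.smul_apply, smul_eq_mul, mul_comm]
  exact (hentry.comp _ hderiv_inv).hasDerivWithinAt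

lemma integral_comp_traceInv (hQ : Q.trace = m) (hΦ : IsDifferentiablePath Q Φ)
    {f : ℝ → Matrix (Fin m) (Fin m) ℝ → ℝ} (hf : ∀ t c A, f t (c • A) = c * f t A)
    (ha : 0 ≤ a) (hab : a ≤ b) (hb : b ≤ m) :
    ∫ s in (Φ a).trace..(Φ b).trace, f (traceInv Φ s) (pathDeriv (Φ ∘ traceInv Φ) s)
      = ∫ t in a..b, f t (pathDeriv Φ t) := by
  have hsub : Ioo a b ⊆ Ioo 0 (m : ℝ) := Ioo_subset_Ioo ha hb
  have hsub' : Icc a b ⊆ Icc 0 (m : ℝ) := Icc_subset_Icc ha hb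
  rw [intervalIntegral.integral_of_le
      (hΦ.monotoneOn_trace (hsub' ⟨le_rfl, hab⟩) (hsub' ⟨hab, le_rfl⟩) hab),
    intervalIntegral.integral_of_le hab, ← integral_Icc_eq_integral_Ioc,
    ← integral_Icc_deriv_smul_of_deriv_nonneg (hΦ.continuousOn_trace.mono hsub')
      (fun t ht => hΦ.hasDerivAt_trace (hsub ht))
      (fun t ht => (hΦ.posSemidef_pathDeriv (hsub' (Ioo_subset_Icc_self ht))).trace_nonneg) hab,
    integral_Icc_eq_integral_Ioo, integral_Ioc_eq_integral_Ioo]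
  refine setIntegral_congr_fun measurableSet_Ioo fun t ht => ?_
  simp only [smul_eq_mul]
  by_cases hne : pathDeriv Φ t = 0
  · have hf0 : f t 0 = 0 := by simpa using hf t 0 0
    rw [hne, hf0, Matrix.trace_zero, zero_mul]
  · have ht' := Ioo_subset_Icc_self (hsub ht)
    rw [hΦ.traceInv_trace hQ ht' hne, hΦ.pathDeriv_comp_traceInv hQ (hsub ht) hne, hf,
      mul_inv_cancel_left₀ (mt (hΦ.posSemidef_pathDeriv ht').trace_eq_zero_iff.1 hne)]

lemma hatPath_comp_traceInv (hQ : Q.trace = m) (hΦ : IsDifferentiablePath Q Φ) (x : ℝ → ℝ)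
    (hs : s ∈ Icc 0 (m : ℝ)) :
    hatPath (x ∘ traceInv Φ) (Φ ∘ traceInv Φ) s = hatPath x Φ (traceInv Φ s) := by
  ext i j
  have ht := hΦ.traceInv_mem hs
  have := hΦ.integral_comp_traceInv hQ (f := fun t A => x t * A i j)
    (fun t c A => by rw [Matrix.smul_apply, smul_eq_mul, mul_left_comm]) ht.1 ht.2 le_rfl
  rwa [hΦ.trace_traceInv hQ hs, hΦ.right_end, hQ] at this

lemma crisantiSommers_comp_traceInv (hQ : Q.trace = m) (hΦ : IsDifferentiablePath Q Φ)
    (β : ℕ → Fin m → ℝ) (h : Fin m → ℝ) (x : ℝ → ℝ) (ht : t ∈ Icc 0 (m : ℝ)) :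
    crisantiSommers β h (Φ t).trace (x ∘ traceInv Φ) (Φ ∘ traceInv Φ)
      = crisantiSommers β h t x Φ := by
  have energy := hΦ.integral_comp_traceInv hQ
    (f := fun t A => x t * pairing (xiDeriv β (Φ t) + Matrix.vecMulVec h h) A)
    (fun t c A => by rw [pairing_smul_right, mul_left_comm]) le_rfl m.cast_nonneg le_rfl
  have entropy := hΦ.integral_comp_traceInv hQ (f := fun t A => pairing (hatPath x Φ t)⁻¹ A)
    (fun t c A => pairing_smul_right c _ A) le_rfl ht.1 ht.2
  rw [hΦ.left_end, Matrix.trace_zero] at energy entropy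
  rw [hΦ.right_end, hQ] at energy
  have hτ := hΦ.trace_mem hQ ht
  have hat_eq : ∀ s ∈ uIcc 0 (Φ t).trace,
      pairing (hatPath (x ∘ traceInv Φ) (Φ ∘ traceInv Φ) s)⁻¹ (pathDeriv (Φ ∘ traceInv Φ) s)
        = pairing (hatPath x Φ (traceInv Φ s))⁻¹ (pathDeriv (Φ ∘ traceInv Φ) s) := fun s hs => by
    rw [uIcc_of_le hτ.1] at hs
    rw [hΦ.hatPath_comp_traceInv hQ x ⟨hs.1, hs.2.trans hτ.2⟩]
  rw [crisantiSommers, crisantiSommers, intervalIntegral.integral_congr hat_eq, entropy, ← energy]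
  simp only [Function.comp_apply, hΦ.traceInv_right_end hQ, hΦ.apply_traceInv_trace hQ ht]

end IsDifferentiablePath

end Reparametrization

/-- Continuously differentiable minimizers of the Crisanti-Sommers functional over the order
parameters and the trace paths. The trace of the path `Φ` itself is not normalized. -/
structure IsC1Minimizer (β : ℕ → Fin m → ℝ) (h : Fin m → ℝ) (Q : Matrix (Fin m) (Fin m) ℝ)
    (x : ℝ → ℝ) (Φ : ℝ → Matrix (Fin m) (Fin m) ℝ) : Prop where
  orderParameter : IsOrderParameter m x
  path : IsC1Path Q Φ
  det_pos : 0 < (Q - Φ (topPoint m x)).det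
  le : ∀ (y : ℝ → ℝ) (Ψ : ℝ → Matrix (Fin m) (Fin m) ℝ), IsOrderParameter m y →
    IsTracePath Q Ψ → 0 < (Q - Ψ (topPoint m y)).det →
    ∀ S T : ℝ, IsCutoff Q x Φ S → IsCutoff Q y Ψ T →
      crisantiSommers β h S x Φ ≤ crisantiSommers β h T y Ψ

section Minimizer

variable {β : ℕ → Fin m → ℝ} {h : Fin m → ℝ} {Q : Matrix (Fin m) (Fin m) ℝ} {x y : ℝ → ℝ}
  {Φ Ψ : ℝ → Matrix (Fin m) (Fin m) ℝ} {S T : ℝ}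

lemma IsMinimizer.isC1Minimizer {μ : Measure ℝ} (hmin : IsMinimizer β h Q x μ Φ) :
    IsC1Minimizer β h Q x Φ where
  orderParameter := hmin.orderParameter
  path :=
    { toIsMonotonePath := hmin.path.toIsMonotonePath
      differentiableOn := fun t ht => (hasDerivWithinAt_pathDeriv fun i j =>
        hmin.path.differentiable i j t ht).differentiableWithinAt
      continuousOn_pathDeriv := by
        obtain ⟨K, hK⟩ := hmin.path.lipschitz_deriv
        exact continuousOn_pi.2 fun i => continuousOn_pi.2 fun j => (hK i j).continuousOn }
  det_pos := hmin.det_pos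
  le := hmin.le

lemma topPoint_comp_traceInv_le (hQ : Q.trace = m) (hΨ : IsDifferentiablePath Q Ψ)
    (hy : IsOrderParameter m y) : topPoint m (y ∘ traceInv Ψ) ≤ (Ψ (topPoint m y)).trace := by
  have htop := hΨ.trace_mem hQ hy.topPoint_mem
  refine topPoint_le htop (hy.eq_one_of_topPoint_le ?_ (hΨ.traceInv_mem htop).2)
  exact (hΨ.le_traceInv_iff hQ htop hy.topPoint_mem).2 le_rfl

lemma isCutoff_comp_traceInv (hQ : Q.trace = m) (hΨ : IsDifferentiablePath Q Ψ)
    (hy : IsOrderParameter m y) (hT : IsCutoff Q y Ψ T)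
    (htrace : (Ψ (topPoint m y)).trace < (Ψ T).trace) :
    IsCutoff Q (y ∘ traceInv Ψ) (Ψ ∘ traceInv Ψ) (Ψ T).trace := by
  have hT0 : 0 < T := hy.topPoint_mem.1.trans_lt hT.1
  have hT' : T ∈ Icc 0 (m : ℝ) := ⟨hT0.le, hT.2.1.le⟩
  have : Nonempty (Fin m) := ⟨⟨0, Nat.cast_pos.1 (hT0.trans hT.2.1)⟩⟩
  refine ⟨(topPoint_comp_traceInv_le hQ hΨ hy).trans_lt htrace,
    (hΨ.trace_mem hQ hT').2.lt_of_ne fun heq => hT.2.2.ne' ?_, ?_⟩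
  · rw [hΨ.eq_of_trace_eq hT' end_mem_timeInterval (by rw [heq, hΨ.right_end, hQ]), hΨ.right_end,
      sub_self, Matrix.det_zero]
  · rw [Function.comp_apply, hΨ.apply_traceInv_trace hQ hT']
    exact hT.2.2

lemma IsC1Minimizer.le_of_isDifferentiablePath (hQ : Q.trace = m)
    (hmin : IsC1Minimizer β h Q x Φ) (hS : IsCutoff Q x Φ S) (hy : IsOrderParameter m y)
    (hΨ : IsDifferentiablePath Q Ψ) (hT : IsCutoff Q y Ψ T)
    (htrace : (Ψ (topPoint m y)).trace < (Ψ T).trace) :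
    crisantiSommers β h S x Φ ≤ crisantiSommers β h T y Ψ := by
  have hT' : T ∈ Icc 0 (m : ℝ) := ⟨hy.topPoint_mem.1.trans hT.1.le, hT.2.1.le⟩
  have hy' := hΨ.isOrderParameter_comp_traceInv hQ hy
  have htop' := hΨ.traceInv_mem hy'.topPoint_mem
  have hle : traceInv Ψ (topPoint m (y ∘ traceInv Ψ)) ≤ T :=
    ((hΨ.traceInv_lt_iff hQ hy'.topPoint_mem hT').2
      ((topPoint_comp_traceInv_le hQ hΨ hy).trans_lt htrace)).le
  have hdet : 0 < (Q - Ψ (traceInv Ψ (topPoint m (y ∘ traceInv Ψ)))).det := by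
    refine (posDef_of_posSemidef_sub (hΨ.posSemidef_sub hT') hT.2.2.ne' ?_).det_pos
    rw [sub_sub_sub_cancel_left]
    exact hΨ.monotone _ htop' _ hT' hle
  rw [← hΨ.crisantiSommers_comp_traceInv hQ β h y hT']
  exact hmin.le _ _ hy' (hΨ.isTracePath_comp_traceInv hQ) hdet _ _ hS
    (isCutoff_comp_traceInv hQ hΨ hy hT htrace)

end Minimizer

section Mixture

/-- The summability condition of `IsMixture` alone. It makes the power series of the entries of
`ξ'` converge beyond the range `[-1, 1]` of the overlaps. -/
def IsSummableMixture (β : ℕ → Fin m → ℝ) : Prop :=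
  ∀ j, Summable fun p : ℕ => (2 : ℝ) ^ (p + 2) * β (p + 2) j ^ 2

/-- The power series `a ↦ ∑_{p ≥ 2} p β_p(i) β_p(j) a^{p-1}` giving the `(i, j)` entry of `ξ'`. -/
def xiEntry (β : ℕ → Fin m → ℝ) (i j : Fin m) (a : ℝ) : ℝ :=
  ∑' p : ℕ, ((p : ℝ) + 2) * (β (p + 2) i * β (p + 2) j) * a ^ (p + 1)

/-- The Taylor coefficients of `xiEntry`. -/
def xiCoeff (β : ℕ → Fin m → ℝ) (i j : Fin m) : ℕ → ℝ
  | 0 => 0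
  | p + 1 => ((p : ℝ) + 2) * (β (p + 2) i * β (p + 2) j)

/-- The Hessian `ξ''(A)`: the matrix of the derivatives of the entries of `ξ'`, each of which
depends on the corresponding entry of `A` only. -/
def xiSecondDeriv (β : ℕ → Fin m → ℝ) (A : Matrix (Fin m) (Fin m) ℝ) :
    Matrix (Fin m) (Fin m) ℝ :=
  Matrix.of fun i j => deriv (xiEntry β i j) (A i j)

variable {β : ℕ → Fin m → ℝ} {H U V : Matrix (Fin m) (Fin m) ℝ}

lemma xiEntry_eq_tsum_xiCoeff (β : ℕ → Fin m → ℝ) (i j : Fin m) (a : ℝ) :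
    xiEntry β i j a = ∑' n, xiCoeff β i j n * a ^ n := by
  by_cases hs : Summable fun n => xiCoeff β i j n * a ^ n
  · rw [hs.tsum_eq_zero_add]
    simp [xiEntry, xiCoeff]
  · rw [tsum_eq_zero_of_not_summable hs]
    exact tsum_eq_zero_of_not_summable fun h => hs ((summable_nat_add_iff 1).1 h)

lemma xiDeriv_zero (β : ℕ → Fin m → ℝ) : xiDeriv β (0 : Matrix (Fin m) (Fin m) ℝ) = 0 := by
  ext i j
  simp [xiDeriv]

lemma add_two_mul_three_fourths_pow_le (p : ℕ) : ((p : ℝ) + 2) * (3 / 4) ^ (p + 1) ≤ 3 := by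
  have hbernoulli := one_add_mul_le_pow (a := (1 / 3 : ℝ)) (by norm_num) (p + 1)
  push_cast at hbernoulli
  calc ((p : ℝ) + 2) * (3 / 4) ^ (p + 1)
      ≤ (3 * (1 + 1 / 3) ^ (p + 1)) * (3 / 4) ^ (p + 1) := by gcongr; linarith
    _ = 3 := by rw [mul_assoc, ← mul_pow]; norm_num

lemma exists_abs_mul_two_pow_le (hβ : IsSummableMixture β) (i j : Fin m) :
    ∃ C, ∀ p, |β (p + 2) i * β (p + 2) j| * 2 ^ (p + 1) ≤ C := by
  refine ⟨_, fun p => le_trans ?_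
    (((hβ i).add (hβ j)).le_tsum p fun _ _ => by positivity)⟩
  have hamgm : |β (p + 2) i * β (p + 2) j| ≤ β (p + 2) i ^ 2 + β (p + 2) j ^ 2 := by
    rw [abs_mul, ← sq_abs (β (p + 2) i), ← sq_abs (β (p + 2) j)]
    nlinarith [sq_nonneg (|β (p + 2) i| - |β (p + 2) j|), sq_nonneg (|β (p + 2) i|),
      sq_nonneg (|β (p + 2) j|)]
  calc |β (p + 2) i * β (p + 2) j| * 2 ^ (p + 1)
      ≤ (β (p + 2) i ^ 2 + β (p + 2) j ^ 2) * 2 ^ (p + 2) := by gcongr <;> norm_num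
    _ = _ := by ring

lemma exists_norm_xiCoeff_mul_le (hβ : IsSummableMixture β) (i j : Fin m) :
    ∃ C, ∀ n, ‖xiCoeff β i j n‖ * (3 / 2 : ℝ) ^ n ≤ C := by
  obtain ⟨C, hC⟩ := exists_abs_mul_two_pow_le hβ i j
  have hC0 : 0 ≤ C := (by positivity : (0 : ℝ) ≤ _).trans (hC 0)
  refine ⟨3 * C, fun n => ?_⟩
  cases n with
  | zero => simpa [xiCoeff] using hC0
  | succ p =>
    have hpow : (3 / 2 : ℝ) ^ (p + 1) = (3 / 4) ^ (p + 1) * 2 ^ (p + 1) := by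
      rw [← mul_pow]; norm_num
    rw [xiCoeff, norm_mul, Real.norm_of_nonneg (by positivity), hpow]
    calc _ = (((p : ℝ) + 2) * (3 / 4 : ℝ) ^ (p + 1))
          * (|β (p + 2) i * β (p + 2) j| * 2 ^ (p + 1)) := by rw [Real.norm_eq_abs]; ring
      _ ≤ 3 * C :=
        mul_le_mul (add_two_mul_three_fourths_pow_le p) (hC p) (by positivity) (by norm_num)

lemma hasFPowerSeriesOnBall_xiEntry (hβ : IsSummableMixture β) (i j : Fin m) :
    HasFPowerSeriesOnBall (xiEntry β i j)
      (FormalMultilinearSeries.ofScalars ℝ (xiCoeff β i j)) 0 (3 / 2 : NNReal) := by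
  set p := FormalMultilinearSeries.ofScalars ℝ (xiCoeff β i j)
  obtain ⟨C, hC⟩ := exists_norm_xiCoeff_mul_le hβ i j
  have hr : ((3 / 2 : NNReal) : ENNReal) ≤ p.radius := by
    refine p.le_radius_of_bound C fun n => ?_
    rw [FormalMultilinearSeries.ofScalars_norm]
    simpa using hC n
  have h0 : (0 : ENNReal) < (3 / 2 : NNReal) := ENNReal.coe_pos.2 (by positivity)
  refine ((p.hasFPowerSeriesOnBall (h0.trans_le hr)).mono h0 hr).congr fun a _ => ?_
  rw [xiEntry_eq_tsum_xiCoeff]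
  simpa using! FormalMultilinearSeries.ofScalars_sum_eq (xiCoeff β i j) a

lemma analyticOnNhd_xiEntry (hβ : IsSummableMixture β) (i j : Fin m) :
    AnalyticOnNhd ℝ (xiEntry β i j) (Ioo (-(3 / 2)) (3 / 2)) := by
  intro a ha
  refine (hasFPowerSeriesOnBall_xiEntry hβ i j).analyticOnNhd a ?_
  rw [Metric.eball_coe, Metric.mem_ball, Real.dist_eq, sub_zero, abs_lt]
  simpa using ha

lemma xiSecondDeriv_zero (hβ : IsSummableMixture β) :
    xiSecondDeriv β 0 = (2 : ℝ) • Matrix.vecMulVec (β 2) (β 2) := by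
  ext i j
  change deriv (xiEntry β i j) 0 = 2 * (β 2 i * β 2 j)
  rw [(hasFPowerSeriesOnBall_xiEntry hβ i j).hasFPowerSeriesAt.hasDerivAt.deriv]
  simp [FormalMultilinearSeries.ofScalars, xiCoeff]

lemma hasDerivWithinAt_xiDeriv (hβ : IsSummableMixture β)
    {F : ℝ → Matrix (Fin m) (Fin m) ℝ} {s : Set ℝ} {t : ℝ} (hF : HasDerivWithinAt F U s t)
    (hFt : ∀ i j, F t i j ∈ Ioo (-(3 / 2) : ℝ) (3 / 2)) :
    HasDerivWithinAt (fun r => xiDeriv β (F r)) (xiSecondDeriv β (F t) ⊙ U) s t :=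
  hasDerivWithinAt_matrix_iff.2 fun i j =>
    HasDerivAt.comp_hasDerivWithinAt (h₂ := xiEntry β i j) t
      (analyticOnNhd_xiEntry hβ i j _ (hFt i j)).differentiableAt.hasDerivAt
      (hasDerivWithinAt_matrix_iff.1 hF i j)

lemma continuousOn_xiSecondDeriv (hβ : IsSummableMixture β) {X : Type*}
    [TopologicalSpace X] {s : Set X} {F : X → Matrix (Fin m) (Fin m) ℝ} (hF : ContinuousOn F s)
    (hFs : ∀ t ∈ s, ∀ i j, F t i j ∈ Ioo (-(3 / 2) : ℝ) (3 / 2)) :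
    ContinuousOn (fun t => xiSecondDeriv β (F t)) s :=
  continuousOn_pi.2 fun i => continuousOn_pi.2 fun j =>
    (analyticOnNhd_xiEntry hβ i j).deriv.continuousOn.comp
      (continuousOn_pi.1 (continuousOn_pi.1 hF i) j) fun t ht => hFs t ht i j

lemma isOpen_setOf_forall_fst_apply_mem_Ioo (a b : ℝ) :
    IsOpen {p : Matrix (Fin m) (Fin m) ℝ × Matrix (Fin m) (Fin m) ℝ |
      ∀ i j, p.1 i j ∈ Ioo a b} := by
  simp only [Set.ofPred_forall]
  exact isOpen_iInter_of_finite fun i => isOpen_iInter_of_finite fun j =>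
    isOpen_Ioo.preimage (continuous_fst.matrix_elem i j)

lemma contDiffOn_pairing_xiDeriv_add (hβ : IsSummableMixture β)
    (H : Matrix (Fin m) (Fin m) ℝ) :
    ContDiffOn ℝ 1 (fun p : Matrix (Fin m) (Fin m) ℝ × Matrix (Fin m) (Fin m) ℝ =>
      pairing (xiDeriv β p.1 + H) p.2) {p | ∀ i j, p.1 i j ∈ Ioo (-(3 / 2) : ℝ) (3 / 2)} := by
  intro p hp
  have hentries : ContDiffAt ℝ 1 (fun A i j => xiEntry β i j (A i j)) p.1 :=
    contDiffAt_pi.2 fun i => contDiffAt_pi.2 fun j =>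
      ContDiffAt.comp p.1 (analyticOnNhd_xiEntry hβ i j _ (hp i j)).contDiffAt
        (Matrix.entryLinearMap ℝ ℝ i j).toContinuousLinearMap.contDiff.contDiffAt
  have hof : ContDiff ℝ 1 (Matrix.of : (Fin m → Fin m → ℝ) → Matrix (Fin m) (Fin m) ℝ) :=
    ((Matrix.ofLinearEquiv ℝ : (Fin m → Fin m → ℝ) ≃ₗ[ℝ] Matrix (Fin m) (Fin m) ℝ
      ).toContinuousLinearEquiv).contDiff
  have hξ : ContDiffAt ℝ 1 (xiDeriv β) p.1 := hof.contDiffAt.comp p.1 hentries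
  exact ((Matrix.traceLinearMap (Fin m) ℝ ℝ).toContinuousLinearMap.contDiff.contDiffAt.comp p
    (((hξ.comp p contDiffAt_fst).add contDiffAt_const).mul contDiffAt_snd)).contDiffWithinAt

lemma pairing_hadamard_left (hU : Uᵀ = U) : pairing (H ⊙ U) V = pairing H (U ⊙ V) := by
  simp only [pairing, Matrix.trace, Matrix.diag, Matrix.mul_apply, Matrix.hadamard_apply]
  refine Finset.sum_congr rfl fun i _ => Finset.sum_congr rfl fun j _ => ?_
  rw [← Matrix.transpose_apply U i j, hU, mul_assoc]

lemma pairing_hadamard_comm (hU : Uᵀ = U) (hV : Vᵀ = V) :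
    pairing (H ⊙ U) V = pairing (H ⊙ V) U := by
  rw [pairing_hadamard_left hU, pairing_hadamard_left hV, Matrix.hadamard_comm]

end Mixture

section HatPath

variable {Q : Matrix (Fin m) (Fin m) ℝ} {x y : ℝ → ℝ} {Φ Ψ : ℝ → Matrix (Fin m) (Fin m) ℝ}
  {s t T : ℝ}

lemma IsOrderParameter.intervalIntegrable_smul {E : Type*} [NormedAddCommGroup E]
    [NormedSpace ℝ E] (hx : IsOrderParameter m x) {F : ℝ → E} (hF : ContinuousOn F (Icc 0 (m : ℝ)))
    (hs : s ∈ Icc 0 (m : ℝ)) (ht : t ∈ Icc 0 (m : ℝ)) :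
    IntervalIntegrable (fun r => x r • F r) volume s t :=
  (hx.intervalIntegrable hs ht).smul_continuousOn (hF.mono (uIcc_subset_Icc hs ht))

namespace IsCutoff

lemma pos (hx : IsOrderParameter m x) (hT : IsCutoff Q x Φ T) : 0 < T :=
  hx.topPoint_mem.1.trans_lt hT.1

lemma mem_Icc (hx : IsOrderParameter m x) (hT : IsCutoff Q x Φ T) : T ∈ Icc 0 (m : ℝ) :=
  ⟨(hT.pos hx).le, hT.2.1.le⟩

lemma Icc_subset (hT : IsCutoff Q x Φ T) : Icc 0 T ⊆ Icc 0 (m : ℝ) :=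
  Icc_subset_Icc_right hT.2.1.le

end IsCutoff

lemma hatPath_eq_integral (hx : IsOrderParameter m x) (hΦ : IsC1Path Q Φ)
    (ht : t ∈ Icc 0 (m : ℝ)) : hatPath x Φ t = ∫ s in t..m, x s • pathDeriv Φ s := by
  ext i j
  exact (Matrix.entryLinearMap ℝ ℝ i j).toContinuousLinearMap.intervalIntegral_comp_comm
    (hx.intervalIntegrable_smul hΦ.continuousOn_pathDeriv ht end_mem_timeInterval)

lemma intervalIntegrable_mul_pathDeriv_apply (hx : IsOrderParameter m x) (hΦ : IsC1Path Q Φ)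
    (ht : t ∈ Icc 0 (m : ℝ)) (i j : Fin m) :
    IntervalIntegrable (fun s => x s * pathDeriv Φ s i j) volume t m :=
  hx.intervalIntegrable_smul (continuousOn_pi.1 (continuousOn_pi.1 hΦ.continuousOn_pathDeriv i) j)
    ht end_mem_timeInterval

lemma IsC1Path.integral_pathDeriv (hΦ : IsC1Path Q Φ) (hs : s ∈ Icc 0 (m : ℝ))
    (ht : t ∈ Icc 0 (m : ℝ)) (hst : s ≤ t) : ∫ r in s..t, pathDeriv Φ r = Φ t - Φ s :=
  have hsub : Icc s t ⊆ Icc 0 (m : ℝ) := Icc_subset_Icc hs.1 ht.2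
  intervalIntegral.integral_eq_sub_of_hasDerivAt_of_le hst (hΦ.continuousOn.mono hsub)
    (fun _ hr => (hΦ.hasDerivWithinAt (hsub (Ioo_subset_Icc_self hr))).hasDerivAt
      (Icc_mem_nhds (hs.1.trans_lt hr.1) (hr.2.trans_le ht.2)))
    ((hΦ.continuousOn_pathDeriv.mono hsub).intervalIntegrable_of_Icc hst)

lemma hatPath_eq_sub (hx : IsOrderParameter m x) (hΦ : IsC1Path Q Φ) (ht : topPoint m x ≤ t)
    (htm : t ≤ m) : hatPath x Φ t = Q - Φ t := by
  have ht' : t ∈ Icc 0 (m : ℝ) := ⟨hx.topPoint_mem.1.trans ht, htm⟩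
  rw [hatPath_eq_integral hx hΦ ht', ← hΦ.right_end,
    ← hΦ.integral_pathDeriv ht' end_mem_timeInterval htm]
  refine intervalIntegral.integral_congr fun s hs => ?_
  rw [uIcc_of_le htm] at hs
  simp only [hx.eq_one_of_topPoint_le (ht.trans hs.1) hs.2, one_smul]

lemma posSemidef_hatPath_sub_hatPath (hx : IsOrderParameter m x) (hΦ : IsC1Path Q Φ)
    (hs : s ∈ Icc 0 (m : ℝ)) (ht : t ∈ Icc 0 (m : ℝ)) (hst : s ≤ t) :
    (hatPath x Φ s - hatPath x Φ t).PosSemidef := by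
  have hint {a b : ℝ} := hx.intervalIntegrable_smul hΦ.continuousOn_pathDeriv (s := a) (t := b)
  rw [hatPath_eq_integral hx hΦ hs, hatPath_eq_integral hx hΦ ht,
    ← intervalIntegral.integral_add_adjacent_intervals (hint hs ht)
      (hint ht end_mem_timeInterval), add_sub_cancel_right]
  refine posSemidef_integral hst fun r hr => ?_
  have hr' : r ∈ Icc 0 (m : ℝ) := ⟨hs.1.trans hr.1, hr.2.trans ht.2⟩
  exact (hΦ.posSemidef_pathDeriv hr').smul (hx.nonneg r hr')

lemma posDef_hatPath (hx : IsOrderParameter m x) (hΦ : IsC1Path Q Φ) (hT : IsCutoff Q x Φ T)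
    (ht : t ∈ Icc 0 T) : (hatPath x Φ t).PosDef := by
  refine posDef_of_posSemidef_sub (hΦ.posSemidef_sub (hT.mem_Icc hx)) hT.2.2.ne' ?_
  rw [← hatPath_eq_sub hx hΦ hT.1.le hT.2.1.le]
  exact posSemidef_hatPath_sub_hatPath hx hΦ (hT.Icc_subset ht) (hT.mem_Icc hx) ht.2

lemma det_hatPath_ne_zero (hx : IsOrderParameter m x) (hΦ : IsC1Path Q Φ)
    (hT : IsCutoff Q x Φ T) (ht : t ∈ Icc 0 T) : (hatPath x Φ t).det ≠ 0 :=
  (posDef_hatPath hx hΦ hT ht).det_pos.ne'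

lemma continuousOn_hatPath (hx : IsOrderParameter m x) (hΦ : IsC1Path Q Φ) :
    ContinuousOn (hatPath x Φ) (Icc 0 (m : ℝ)) := by
  have hint := hx.intervalIntegrable_smul hΦ.continuousOn_pathDeriv zero_mem_timeInterval
    end_mem_timeInterval
  rw [intervalIntegrable_iff_integrableOn_Icc_of_le m.cast_nonneg,
    ← uIcc_of_le m.cast_nonneg] at hint
  refine ContinuousOn.congr ?_ fun t ht => hatPath_eq_integral hx hΦ ht
  rw [← uIcc_of_le m.cast_nonneg]
  exact intervalIntegral.continuousOn_primitive_interval_left hint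

lemma hasDerivWithinAt_hatPath (hx : IsOrderParameter m x) (hΦ : IsC1Path Q Φ)
    (ht : t ∈ Ico 0 (m : ℝ)) :
    HasDerivWithinAt (hatPath x Φ) (-(x t • pathDeriv Φ t)) (Ioi t) t := by
  have hint := hx.intervalIntegrable_smul hΦ.continuousOn_pathDeriv (Ico_subset_Icc_self ht)
    end_mem_timeInterval
  have hΦ' : ContinuousWithinAt (pathDeriv Φ) (Ioi t) t :=
    (hΦ.continuousOn_pathDeriv t (Ico_subset_Icc_self ht)).mono_of_mem_nhdsWithin
      (mem_of_superset (Ioo_mem_nhdsGT ht.2) fun s hs => ⟨ht.1.trans hs.1.le, hs.2.le⟩)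
  have hderiv := intervalIntegral.integral_hasDerivWithinAt_left (s := Ici t) (t := Ioi t) hint
    (AEStronglyMeasurable.stronglyMeasurableAtFilter_of_mem
      ((intervalIntegrable_iff_integrableOn_Ioo_of_le ht.2.le).1 hint).aestronglyMeasurable
      (Ioo_mem_nhdsGT ht.2))
    (((hx.rightContinuous t ht).mono Ioi_subset_Ici_self).smul hΦ')
  refine (hderiv.mono Ioi_subset_Ici_self).congr_of_eventuallyEq ?_
    (hatPath_eq_integral hx hΦ (Ico_subset_Icc_self ht))
  filter_upwards [Ioo_mem_nhdsGT ht.2] with s hs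
  exact hatPath_eq_integral hx hΦ ⟨ht.1.trans hs.1.le, hs.2.le⟩

lemma hatPath_add_smul_sub_left (hx : IsOrderParameter m x) (hy : IsOrderParameter m y)
    (hΦ : IsC1Path Q Φ) (ε : ℝ) (ht : t ∈ Icc 0 (m : ℝ)) :
    hatPath (x + ε • (y - x)) Φ t
      = hatPath x Φ t + ε • (hatPath y Φ t - hatPath x Φ t) := by
  ext i j
  refine Eq.trans (intervalIntegral.integral_congr fun s _ => ?_)
    (integral_add_smul_sub (intervalIntegrable_mul_pathDeriv_apply hx hΦ ht i j)
      (intervalIntegrable_mul_pathDeriv_apply hy hΦ ht i j) ε)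
  simp only [Pi.add_apply, Pi.smul_apply, Pi.sub_apply, smul_eq_mul]
  ring

lemma hatPath_add_smul_sub_right (hx : IsOrderParameter m x) (hΦ : IsC1Path Q Φ)
    (hΨ : IsC1Path Q Ψ) (ε : ℝ) (ht : t ∈ Icc 0 (m : ℝ)) :
    hatPath x (Φ + ε • (Ψ - Φ)) t
      = hatPath x Φ t + ε • (hatPath x Ψ t - hatPath x Φ t) := by
  ext i j
  refine Eq.trans (intervalIntegral.integral_congr fun s hs => ?_)
    (integral_add_smul_sub (intervalIntegrable_mul_pathDeriv_apply hx hΦ ht i j)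
      (intervalIntegrable_mul_pathDeriv_apply hx hΨ ht i j) ε)
  simp only [hΦ.pathDeriv_add_smul_sub hΨ.toIsDifferentiablePath ε
    (uIcc_subset_Icc ht end_mem_timeInterval hs), Matrix.add_apply, Matrix.smul_apply,
    Matrix.sub_apply, smul_eq_mul]
  ring

end HatPath

section Gradient

variable {β : ℕ → Fin m → ℝ} {Q : Matrix (Fin m) (Fin m) ℝ} {x y : ℝ → ℝ}
  {Φ Ψ : ℝ → Matrix (Fin m) (Fin m) ℝ} {t T : ℝ}

lemma IsMonotonePath.apply_mem_Ioo (hΦ : IsMonotonePath Q Φ) (hQ : IsConstraint Q)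
    (ht : t ∈ Icc 0 (m : ℝ)) (i j : Fin m) : Φ t i j ∈ Ioo (-(3 / 2) : ℝ) (3 / 2) := by
  have diag_le_one (k : Fin m) : Φ t k k ≤ 1 := by
    have := (hΦ.posSemidef_sub ht).diag_nonneg (i := k)
    rwa [Matrix.sub_apply, hQ.diag k, sub_nonneg] at this
  have := abs_le.1 (abs_apply_le_half_diag_add (hΦ.posSemidef t ht) i j)
  constructor <;> linarith [diag_le_one i, diag_le_one j]

/-- `Φ̂(t)⁻¹ Φ'(t) Φ̂(t)⁻¹`; wherever `x = 1` it is the derivative of `t ↦ Φ̂(t)⁻¹`. -/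
def sandwich (x : ℝ → ℝ) (Φ : ℝ → Matrix (Fin m) (Fin m) ℝ) (t : ℝ) :
    Matrix (Fin m) (Fin m) ℝ :=
  (hatPath x Φ t)⁻¹ * pathDeriv Φ t * (hatPath x Φ t)⁻¹

/-- `∫_0^t Φ̂⁻¹ Φ' Φ̂⁻¹`. -/
def sandwichIntegral (x : ℝ → ℝ) (Φ : ℝ → Matrix (Fin m) (Fin m) ℝ) (t : ℝ) :
    Matrix (Fin m) (Fin m) ℝ :=
  ∫ s in (0 : ℝ)..t, sandwich x Φ s

/-- The matrix `G(t) = ξ'(Φ(t)) - ∫_0^t Φ̂⁻¹ Φ' Φ̂⁻¹` through which, up to `h hᵀ`, both first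
variations of the Crisanti-Sommers functional are expressed. -/
def gradient (β : ℕ → Fin m → ℝ) (x : ℝ → ℝ) (Φ : ℝ → Matrix (Fin m) (Fin m) ℝ) (t : ℝ) :
    Matrix (Fin m) (Fin m) ℝ :=
  xiDeriv β (Φ t) - sandwichIntegral x Φ t

/-- The derivative of `gradient β x Φ` along the path. -/
def gradientDeriv (β : ℕ → Fin m → ℝ) (x : ℝ → ℝ) (Φ : ℝ → Matrix (Fin m) (Fin m) ℝ) (t : ℝ) :
    Matrix (Fin m) (Fin m) ℝ :=
  xiSecondDeriv β (Φ t) ⊙ pathDeriv Φ t - sandwich x Φ t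

lemma sandwichIntegral_zero : sandwichIntegral x Φ 0 = 0 :=
  intervalIntegral.integral_same

lemma gradient_zero (hΦ : IsMonotonePath Q Φ) : gradient β x Φ 0 = 0 := by
  rw [gradient, hΦ.left_end, xiDeriv_zero, sandwichIntegral_zero, sub_zero]

lemma continuousOn_inv_hatPath (hx : IsOrderParameter m x) (hΦ : IsC1Path Q Φ)
    (hT : IsCutoff Q x Φ T) : ContinuousOn (fun t => (hatPath x Φ t)⁻¹) (Icc 0 T) :=
  continuousOn_matrix_inv ((continuousOn_hatPath hx hΦ).mono hT.Icc_subset)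
    fun _ ht => det_hatPath_ne_zero hx hΦ hT ht

lemma continuousOn_sandwich (hx : IsOrderParameter m x) (hΦ : IsC1Path Q Φ)
    (hT : IsCutoff Q x Φ T) : ContinuousOn (sandwich x Φ) (Icc 0 T) :=
  have hinv := continuousOn_inv_hatPath hx hΦ hT
  (hinv.mul (hΦ.continuousOn_pathDeriv.mono hT.Icc_subset)).mul hinv

lemma hasDerivWithinAt_sandwichIntegral (hx : IsOrderParameter m x) (hΦ : IsC1Path Q Φ)
    (hT : IsCutoff Q x Φ T) (ht : t ∈ Icc 0 T) :
    HasDerivWithinAt (sandwichIntegral x Φ) (sandwich x Φ t) (Icc 0 T) t :=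
  hasDerivWithinAt_integral (continuousOn_sandwich hx hΦ hT) ht

lemma continuousOn_sandwichIntegral (hx : IsOrderParameter m x) (hΦ : IsC1Path Q Φ)
    (hT : IsCutoff Q x Φ T) : ContinuousOn (sandwichIntegral x Φ) (Icc 0 T) := fun _ ht =>
  (hasDerivWithinAt_sandwichIntegral hx hΦ hT ht).continuousWithinAt

lemma hasDerivWithinAt_xiDeriv_path (hβ : IsSummableMixture β) (hQ : IsConstraint Q)
    (hΦ : IsDifferentiablePath Q Φ) (ht : t ∈ Icc 0 (m : ℝ)) :
    HasDerivWithinAt (fun r => xiDeriv β (Φ r)) (xiSecondDeriv β (Φ t) ⊙ pathDeriv Φ t)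
      (Icc 0 (m : ℝ)) t :=
  hasDerivWithinAt_xiDeriv hβ (hΦ.hasDerivWithinAt ht) (hΦ.apply_mem_Ioo hQ ht)

lemma continuousOn_xiDeriv_path (hβ : IsSummableMixture β) (hQ : IsConstraint Q)
    (hΦ : IsDifferentiablePath Q Φ) : ContinuousOn (fun t => xiDeriv β (Φ t)) (Icc 0 (m : ℝ)) :=
  fun _ ht => (hasDerivWithinAt_xiDeriv_path hβ hQ hΦ ht).continuousWithinAt

lemma hasDerivWithinAt_gradient (hβ : IsSummableMixture β) (hQ : IsConstraint Q)
    (hx : IsOrderParameter m x) (hΦ : IsC1Path Q Φ) (hT : IsCutoff Q x Φ T) (ht : t ∈ Icc 0 T) :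
    HasDerivWithinAt (gradient β x Φ) (gradientDeriv β x Φ t) (Icc 0 T) t :=
  ((hasDerivWithinAt_xiDeriv_path hβ hQ hΦ.toIsDifferentiablePath (hT.Icc_subset ht)).mono
    hT.Icc_subset).sub (hasDerivWithinAt_sandwichIntegral hx hΦ hT ht)

lemma continuousOn_gradient (hβ : IsSummableMixture β) (hQ : IsConstraint Q)
    (hx : IsOrderParameter m x) (hΦ : IsC1Path Q Φ) (hT : IsCutoff Q x Φ T) :
    ContinuousOn (gradient β x Φ) (Icc 0 T) := fun _ ht =>
  (hasDerivWithinAt_gradient hβ hQ hx hΦ hT ht).continuousWithinAt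

lemma continuousOn_xiSecondDeriv_hadamard_pathDeriv (hβ : IsSummableMixture β)
    (hQ : IsConstraint Q) (hΦ : IsC1Path Q Φ) :
    ContinuousOn (fun t => xiSecondDeriv β (Φ t) ⊙ pathDeriv Φ t) (Icc 0 (m : ℝ)) := by
  have hxi := continuousOn_xiSecondDeriv hβ hΦ.continuousOn fun t ht => hΦ.apply_mem_Ioo hQ ht
  exact continuousOn_pi.2 fun i => continuousOn_pi.2 fun j =>
    (continuousOn_pi.1 (continuousOn_pi.1 hxi i) j).mul
      (continuousOn_pi.1 (continuousOn_pi.1 hΦ.continuousOn_pathDeriv i) j)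

lemma continuousOn_gradientDeriv (hβ : IsSummableMixture β) (hQ : IsConstraint Q)
    (hx : IsOrderParameter m x) (hΦ : IsC1Path Q Φ) (hT : IsCutoff Q x Φ T) :
    ContinuousOn (gradientDeriv β x Φ) (Icc 0 T) :=
  ((continuousOn_xiSecondDeriv_hadamard_pathDeriv hβ hQ hΦ).mono hT.Icc_subset).sub
    (continuousOn_sandwich hx hΦ hT)

lemma pairing_mul_mul_comm (A B C : Matrix (Fin m) (Fin m) ℝ) :
    pairing (A * B * A) C = pairing (A * C * A) B := by
  simpa only [pairing, mul_assoc] using Matrix.trace_mul_comm (A * B) (A * C)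

lemma pairing_inv_mul_mul_inv_pathDeriv (A : Matrix (Fin m) (Fin m) ℝ) :
    pairing ((hatPath x Φ t)⁻¹ * A * (hatPath x Φ t)⁻¹) (pathDeriv Φ t)
      = pairing (sandwich x Φ t) A :=
  pairing_mul_mul_comm _ _ _

lemma integral_pairing_deriv_add {F G F' G' : ℝ → Matrix (Fin m) (Fin m) ℝ} {a b : ℝ}
    (hab : a ≤ b) (hF : ContinuousOn F (Icc a b)) (hG : ContinuousOn G (Icc a b))
    (hF' : ∀ t ∈ Ioo a b, HasDerivWithinAt F (F' t) (Ioi t) t)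
    (hG' : ∀ t ∈ Ioo a b, HasDerivWithinAt G (G' t) (Ioi t) t)
    (hFG' : IntervalIntegrable (fun t => pairing (F' t) (G t)) volume a b)
    (hGF' : IntervalIntegrable (fun t => pairing (F t) (G' t)) volume a b) :
    (∫ t in a..b, pairing (F' t) (G t)) + ∫ t in a..b, pairing (F t) (G' t)
      = pairing (F b) (G b) - pairing (F a) (G a) := by
  rw [← intervalIntegral.integral_add hFG' hGF']
  exact intervalIntegral.integral_eq_sub_of_hasDeriv_right_of_le hab (continuousOn_pairing hF hG)
    (fun t ht => hasDerivWithinAt_pairing (hF' t ht) (hG' t ht)) (hFG'.add hGF')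

lemma integral_pairing_sandwich_hatPath (hx : IsOrderParameter m x) (hΦ : IsC1Path Q Φ)
    (hT : IsCutoff Q x Φ T) (hy : IsOrderParameter m y) (hΨ : IsC1Path Q Ψ) :
    ∫ t in (0 : ℝ)..T, pairing (sandwich x Φ t) (hatPath y Ψ t)
      = pairing (sandwichIntegral x Φ T) (hatPath y Ψ T)
        + ∫ t in (0 : ℝ)..T, y t * pairing (sandwichIntegral x Φ t) (pathDeriv Ψ t) := by
  have hS := continuousOn_sandwichIntegral hx hΦ hT
  have hΨ' := hΨ.continuousOn_pathDeriv.mono hT.Icc_subset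
  have hhat := (continuousOn_hatPath hy hΨ).mono hT.Icc_subset
  have hT0 := (hT.pos hx).le
  have hy_int : IntervalIntegrable y volume 0 T :=
    hy.intervalIntegrable zero_mem_timeInterval (hT.mem_Icc hx)
  have hibp := integral_pairing_deriv_add hT0 hS hhat (G' := fun t => -(y t) • pathDeriv Ψ t)
    (fun t ht => ((hasDerivWithinAt_sandwichIntegral hx hΦ hT
      (Ioo_subset_Icc_self ht)).hasDerivAt (Icc_mem_nhds ht.1 ht.2)).hasDerivWithinAt)
    (fun t ht => by
      rw [neg_smul]
      exact hasDerivWithinAt_hatPath hy hΨ ⟨ht.1.le, ht.2.trans hT.2.1⟩)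
    ((continuousOn_pairing (continuousOn_sandwich hx hΦ hT) hhat).intervalIntegrable_of_Icc hT0)
    (by
      simp only [pairing_smul_right]
      exact hy_int.neg.mul_continuousOn
        (by simpa only [uIcc_of_le hT0] using continuousOn_pairing hS hΨ'))
  simp only [pairing_smul_right, neg_mul, intervalIntegral.integral_neg, sandwichIntegral_zero,
    pairing_zero_left, sub_zero] at hibp
  linarith

lemma integral_pairing_inv_hatPath (hx : IsOrderParameter m x) (hΦ : IsC1Path Q Φ)
    (hT : IsCutoff Q x Φ T) (hΨ : IsC1Path Q Ψ) :
    ∫ t in (0 : ℝ)..T, pairing (hatPath x Φ t)⁻¹ (pathDeriv Ψ t)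
      = pairing (hatPath x Φ T)⁻¹ (Ψ T)
        - ∫ t in (0 : ℝ)..T, x t * pairing (sandwich x Φ t) (Ψ t) := by
  have hΨc := hΨ.continuousOn.mono hT.Icc_subset
  have hT0 := (hT.pos hx).le
  have hinv := continuousOn_inv_hatPath hx hΦ hT
  have hibp := integral_pairing_deriv_add hT0 hinv hΨc (F' := fun t => x t • sandwich x Φ t)
    (fun t ht => by
      have := hasDerivWithinAt_matrix_inv
        (hasDerivWithinAt_hatPath hx hΦ ⟨ht.1.le, ht.2.trans hT.2.1⟩)
        (det_hatPath_ne_zero hx hΦ hT (Ioo_subset_Icc_self ht))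
      simpa only [sandwich, mul_neg, neg_mul, neg_neg, mul_smul_comm, smul_mul_assoc] using this)
    (fun t ht => (hΨ.hasDerivWithinAt
      (hT.Icc_subset (Ioo_subset_Icc_self ht))).mono_of_mem_nhdsWithin
      (mem_of_superset (Ioo_mem_nhdsGT (ht.2.trans hT.2.1)) fun s hs =>
        ⟨ht.1.le.trans hs.1.le, hs.2.le⟩))
    (by
      simp only [pairing_smul_left]
      exact (hx.intervalIntegrable zero_mem_timeInterval (hT.mem_Icc hx)).mul_continuousOn
        (by simpa only [uIcc_of_le hT0] using
          continuousOn_pairing (continuousOn_sandwich hx hΦ hT) hΨc))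
    ((continuousOn_pairing hinv (hΨ.continuousOn_pathDeriv.mono
      hT.Icc_subset)).intervalIntegrable_of_Icc hT0)
  simp only [pairing_smul_left, hΨ.left_end, pairing_zero_right, sub_zero] at hibp
  linarith

end Gradient

section Variation

variable {β : ℕ → Fin m → ℝ} {h : Fin m → ℝ} {Q : Matrix (Fin m) (Fin m) ℝ} {x y : ℝ → ℝ}
  {Φ Ψ : ℝ → Matrix (Fin m) (Fin m) ℝ} {T : ℝ}

lemma integral_eq_of_eqOn_zero {f : ℝ → ℝ} {a b c : ℝ} (hb : b ∈ Icc a c)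
    (hf : IntervalIntegrable f volume a c) (hzero : EqOn f 0 (Icc b c)) :
    ∫ t in a..c, f t = ∫ t in a..b, f t := by
  have hb' : b ∈ uIcc a c := uIcc_of_le (hb.1.trans hb.2) ▸ hb
  have hbc : ∫ t in b..c, f t = 0 :=
    (intervalIntegral.integral_congr (uIcc_of_le hb.2 ▸ hzero)).trans
      intervalIntegral.integral_zero
  rw [← intervalIntegral.integral_add_adjacent_intervals
    (hf.mono_set (uIcc_subset_uIcc_left hb')) (hf.mono_set (uIcc_subset_uIcc_right hb')),
    hbc, add_zero]

lemma hasDerivAt_pairing_inv_add_smul {U : Matrix (Fin m) (Fin m) ℝ} (hU : U.det ≠ 0)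
    (V W Y : Matrix (Fin m) (Fin m) ℝ) :
    HasDerivAt (fun ε : ℝ => pairing (U + ε • V)⁻¹ (W + ε • Y))
      (pairing U⁻¹ Y - pairing (U⁻¹ * V * U⁻¹) W) 0 := by
  have := hasDerivWithinAt_pairing (hasDerivWithinAt_matrix_inv
    (hasDerivWithinAt_add_smul U V univ) (by simpa only [zero_smul, add_zero] using hU))
    (hasDerivWithinAt_add_smul W Y univ)
  simp only [zero_smul, add_zero] at this
  refine (this.hasDerivAt univ_mem).congr_deriv ?_
  rw [← zero_sub, pairing_sub_left, pairing_zero_left]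
  ring

lemma hasDerivAt_pairing_xiDeriv_add_smul (hβ : IsSummableMixture β)
    {A : Matrix (Fin m) (Fin m) ℝ} (hA : ∀ i j, A i j ∈ Ioo (-(3 / 2) : ℝ) (3 / 2))
    (H B C D : Matrix (Fin m) (Fin m) ℝ) :
    HasDerivAt (fun ε : ℝ => pairing (xiDeriv β (A + ε • B) + H) (C + ε • D))
      (pairing (xiSecondDeriv β A ⊙ B) C + pairing (xiDeriv β A + H) D) 0 := by
  have hξ := hasDerivWithinAt_xiDeriv hβ (hasDerivWithinAt_add_smul A B univ)
    (by simpa only [zero_smul, add_zero] using hA)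
  have := hasDerivWithinAt_pairing (hξ.add_const H) (hasDerivWithinAt_add_smul C D univ)
  simp only [zero_smul, add_zero] at this
  exact this.hasDerivAt univ_mem

lemma hasDerivAt_integral_pairing_inv {U V W Y : ℝ → Matrix (Fin m) (Fin m) ℝ} {a b : ℝ}
    (hab : a ≤ b) (hU : ContinuousOn U (Icc a b)) (hV : ContinuousOn V (Icc a b))
    (hW : ContinuousOn W (Icc a b)) (hY : ContinuousOn Y (Icc a b))
    (hdet : ∀ t ∈ Icc a b, (U t).det ≠ 0) :
    HasDerivAt (fun ε : ℝ => ∫ t in a..b, pairing (U t + ε • V t)⁻¹ (W t + ε • Y t))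
      (∫ t in a..b, (pairing (U t)⁻¹ (Y t) - pairing ((U t)⁻¹ * V t * (U t)⁻¹) (W t))) 0 := by
  have hderiv := hasDerivAt_integral_mul_comp_line isOpen_setOf_det_fst_ne_zero
    contDiffOn_pairing_inv hab (w := fun _ => 1) intervalIntegrable_const (hU.prodMk hW)
    (hV.prodMk hY) hdet fun t ht => hasDerivAt_pairing_inv_add_smul (hdet t ht) (V t) (W t) (Y t)
  simp only [one_mul] at hderiv
  exact hderiv

lemma IsOrderParameter.intervalIntegrable_mul_of_continuousOn (hx : IsOrderParameter m x)
    {f : ℝ → ℝ} (hT : T ∈ Icc 0 (m : ℝ)) (hf : ContinuousOn f (Icc 0 T)) :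
    IntervalIntegrable (fun t => x t * f t) volume 0 T :=
  (hx.intervalIntegrable zero_mem_timeInterval hT).mul_continuousOn (by rwa [uIcc_of_le hT.1])

lemma hasDerivAt_integral_orderParameter_mul {f : ℝ → ℝ} (hf : ContinuousOn f (Icc 0 (m : ℝ)))
    (hx : IsOrderParameter m x) (hy : IsOrderParameter m y) (hT : T ∈ Icc 0 (m : ℝ))
    (hyx : EqOn y x (Icc T m)) :
    HasDerivAt (fun ε : ℝ => ∫ t in (0 : ℝ)..m, (x + ε • (y - x)) t * f t)
      (∫ t in (0 : ℝ)..T, (y t - x t) * f t) 0 := by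
  have hxf := hx.intervalIntegrable_mul_of_continuousOn end_mem_timeInterval hf
  have hyf := hy.intervalIntegrable_mul_of_continuousOn end_mem_timeInterval hf
  have affine (ε : ℝ) : ∫ t in (0 : ℝ)..m, (x + ε • (y - x)) t * f t
      = (∫ t in (0 : ℝ)..m, x t * f t) + ε • ∫ t in (0 : ℝ)..T, (y t - x t) * f t := by
    rw [← integral_eq_of_eqOn_zero hT (by simpa only [sub_mul] using hyf.sub hxf)
      fun t ht => by simp only [hyx ht, sub_self, zero_mul, Pi.zero_apply]]
    simp only [sub_mul]
    rw [intervalIntegral.integral_sub hyf hxf, ← integral_add_smul_sub hxf hyf ε]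
    refine intervalIntegral.integral_congr fun t _ => ?_
    simp only [Pi.add_apply, Pi.smul_apply, Pi.sub_apply, smul_eq_mul]
    ring
  simp only [affine]
  exact (hasDerivWithinAt_add_smul _ _ univ).hasDerivAt univ_mem

lemma hasDerivAt_integral_pairing_inv_hatPath_orderParameter
    (hx : IsOrderParameter m x) (hΦ : IsC1Path Q Φ) (hT : IsCutoff Q x Φ T)
    (hy : IsOrderParameter m y) (hyx : EqOn y x (Icc T m)) :
    HasDerivAt
      (fun ε : ℝ => ∫ t in (0 : ℝ)..T, pairing (hatPath (x + ε • (y - x)) Φ t)⁻¹ (pathDeriv Φ t))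
      (-∫ t in (0 : ℝ)..T, (y t - x t) * pairing (sandwichIntegral x Φ t) (pathDeriv Φ t)) 0 := by
  have hT0 := (hT.pos hx).le
  have hΦ' := hΦ.continuousOn_pathDeriv.mono hT.Icc_subset
  have hhat {z : ℝ → ℝ} (hz : IsOrderParameter m z) :=
    (continuousOn_hatPath hz hΦ).mono hT.Icc_subset
  have hderiv := hasDerivAt_integral_pairing_inv hT0 (hhat hx) ((hhat hy).sub (hhat hx))
    hΦ' (continuousOn_const (c := 0)) fun t ht => det_hatPath_ne_zero hx hΦ hT ht
  have hhatT : hatPath y Φ T = hatPath x Φ T := by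
    ext i j
    refine intervalIntegral.integral_congr fun t ht => ?_
    simp only [hyx (uIcc_of_le hT.2.1.le ▸ ht)]
  have integrable_sandwich {z : ℝ → ℝ} (hz : IsOrderParameter m z) :
      IntervalIntegrable (fun t => pairing (sandwich x Φ t) (hatPath z Φ t)) volume 0 T :=
    (continuousOn_pairing (continuousOn_sandwich hx hΦ hT) (hhat hz)).intervalIntegrable_of_Icc hT0
  have integrable_pathDeriv {z : ℝ → ℝ} (hz : IsOrderParameter m z) :=
    hz.intervalIntegrable_mul_of_continuousOn (hT.mem_Icc hx)
      (continuousOn_pairing (continuousOn_sandwichIntegral hx hΦ hT) hΦ')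
  refine (hderiv.congr_deriv ?_).congr_of_eventuallyEq (.of_forall fun ε => ?_)
  · simp only [pairing_zero_right, zero_sub, pairing_inv_mul_mul_inv_pathDeriv,
      Pi.sub_apply, pairing_sub_right, intervalIntegral.integral_neg, sub_mul]
    rw [intervalIntegral.integral_sub (integrable_pathDeriv hy) (integrable_pathDeriv hx),
      intervalIntegral.integral_sub (integrable_sandwich hy) (integrable_sandwich hx),
      integral_pairing_sandwich_hatPath hx hΦ hT hy hΦ,
      integral_pairing_sandwich_hatPath hx hΦ hT hx hΦ, hhatT]
    ring
  · refine intervalIntegral.integral_congr fun t ht => ?_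
    simp only [hatPath_add_smul_sub_left hx hy hΦ ε (hT.Icc_subset (uIcc_of_le hT0 ▸ ht)),
      Pi.sub_apply, smul_zero, add_zero]

lemma hasDerivAt_crisantiSommers_orderParameter (hβ : IsSummableMixture β) (hQ : IsConstraint Q)
    (hx : IsOrderParameter m x) (hΦ : IsC1Path Q Φ) (hT : IsCutoff Q x Φ T)
    (hy : IsOrderParameter m y) (hyx : EqOn y x (Icc T m)) :
    HasDerivAt (fun ε : ℝ => crisantiSommers β h T (x + ε • (y - x)) Φ)
      (1 / 2 * ∫ t in (0 : ℝ)..T, (y t - x t)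
        * pairing (gradient β x Φ t + Matrix.vecMulVec h h) (pathDeriv Φ t)) 0 := by
  have hΦ' := hΦ.continuousOn_pathDeriv
  have hxi : ContinuousOn
      (fun t => pairing (xiDeriv β (Φ t) + Matrix.vecMulVec h h) (pathDeriv Φ t))
      (Icc 0 (m : ℝ)) := continuousOn_pairing
    ((continuousOn_xiDeriv_path hβ hQ hΦ.toIsDifferentiablePath).add continuousOn_const) hΦ'
  have hS := continuousOn_pairing (continuousOn_sandwichIntegral hx hΦ hT) (hΦ'.mono hT.Icc_subset)
  have integrable {f : ℝ → ℝ} (hf : ContinuousOn f (Icc 0 T)) :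
      IntervalIntegrable (fun t => (y t - x t) * f t) volume 0 T := by
    simp only [sub_mul]
    exact (hy.intervalIntegrable_mul_of_continuousOn (hT.mem_Icc hx) hf).sub
      (hx.intervalIntegrable_mul_of_continuousOn (hT.mem_Icc hx) hf)
  refine ((((hasDerivAt_integral_orderParameter_mul hxi hx hy (hT.mem_Icc hx) hyx).add_const
    (Real.log (Φ m - Φ T).det)).add (hasDerivAt_integral_pairing_inv_hatPath_orderParameter hx hΦ hT
    hy hyx)).const_mul (1 / 2)).congr_deriv ?_
  rw [← sub_eq_add_neg, ← intervalIntegral.integral_sub (integrable (hxi.mono hT.Icc_subset))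
    (integrable hS)]
  congr 1
  refine intervalIntegral.integral_congr fun t _ => ?_
  simp only [gradient, pairing_add_left, pairing_sub_left]
  ring

lemma hasDerivAt_integral_pairing_xiDeriv_path (hβ : IsSummableMixture β) (hQ : IsConstraint Q)
    (hx : IsOrderParameter m x) (hΦ : IsC1Path Q Φ) (hΨ : IsC1Path Q Ψ) (hT : T ∈ Ico 0 (m : ℝ))
    (hΨΦ : EqOn Ψ Φ (Icc T m)) :
    HasDerivAt (fun ε : ℝ => ∫ t in (0 : ℝ)..m, x t * pairing
        (xiDeriv β ((Φ + ε • (Ψ - Φ)) t) + Matrix.vecMulVec h h) (pathDeriv (Φ + ε • (Ψ - Φ)) t))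
      (∫ t in (0 : ℝ)..T, x t *
        (pairing (xiSecondDeriv β (Φ t) ⊙ pathDeriv Φ t) (Ψ t - Φ t)
          + pairing (xiDeriv β (Φ t) + Matrix.vecMulVec h h) (pathDeriv Ψ t - pathDeriv Φ t)))
      0 := by
  have hΦ' := hΦ.continuousOn_pathDeriv
  have hv := hΨ.continuousOn.sub hΦ.continuousOn
  have hv' := hΨ.continuousOn_pathDeriv.sub hΦ'
  have symm {t : ℝ} (ht : t ∈ Icc 0 (m : ℝ)) :
      pairing (xiSecondDeriv β (Φ t) ⊙ (Ψ t - Φ t)) (pathDeriv Φ t)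
        = pairing (xiSecondDeriv β (Φ t) ⊙ pathDeriv Φ t) (Ψ t - Φ t) :=
    pairing_hadamard_comm ((hΨ.posSemidef t ht).isHermitian.sub (hΦ.posSemidef t ht).isHermitian)
      (hΦ.posSemidef_pathDeriv ht).isHermitian
  have hderiv := hasDerivAt_integral_mul_comp_line
    (isOpen_setOf_forall_fst_apply_mem_Ioo (-(3 / 2)) (3 / 2))
    (contDiffOn_pairing_xiDeriv_add hβ (Matrix.vecMulVec h h)) m.cast_nonneg
    (hx.intervalIntegrable zero_mem_timeInterval end_mem_timeInterval)
    (hΦ.continuousOn.prodMk hΦ') (hv.prodMk hv') (fun t ht => hΦ.apply_mem_Ioo hQ ht)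
    fun t ht => (hasDerivAt_pairing_xiDeriv_add_smul hβ (hΦ.apply_mem_Ioo hQ ht)
      (Matrix.vecMulVec h h) (Ψ t - Φ t) (pathDeriv Φ t) (pathDeriv Ψ t - pathDeriv Φ t)
      ).congr_deriv (congrArg (· + _) (symm ht))
  refine (hderiv.congr_deriv (integral_eq_of_eqOn_zero (Ico_subset_Icc_self hT)
    (hx.intervalIntegrable_mul_of_continuousOn end_mem_timeInterval
      ((continuousOn_pairing (continuousOn_xiSecondDeriv_hadamard_pathDeriv hβ hQ hΦ) hv).add
        (continuousOn_pairing ((continuousOn_xiDeriv_path hβ hQ hΦ.toIsDifferentiablePath).add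
          continuousOn_const) hv'))) fun t ht => ?_)).congr_of_eventuallyEq
    (.of_forall fun ε => intervalIntegral.integral_congr fun t ht => ?_)
  · simp only [hΨΦ ht, hΦ.eqOn_pathDeriv hΨ.toIsDifferentiablePath hT hΨΦ ht, sub_self,
      pairing_zero_right, add_zero, mul_zero, Pi.zero_apply]
  · simp only [hΦ.pathDeriv_add_smul_sub hΨ.toIsDifferentiablePath ε
      (uIcc_of_le (α := ℝ) m.cast_nonneg ▸ ht)]
    rfl

lemma integral_pairing_inv_hatPath_sub_sandwich (hx : IsOrderParameter m x) (hΦ : IsC1Path Q Φ)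
    (hT : IsCutoff Q x Φ T) (hΨ : IsC1Path Q Ψ) :
    ∫ t in (0 : ℝ)..T,
        (pairing (hatPath x Φ t)⁻¹ (pathDeriv Ψ t) - pairing (sandwich x Φ t) (hatPath x Ψ t))
      = pairing (hatPath x Φ T)⁻¹ (Ψ T) - pairing (sandwichIntegral x Φ T) (hatPath x Ψ T)
        - ∫ t in (0 : ℝ)..T, x t * (pairing (sandwich x Φ t) (Ψ t)
            + pairing (sandwichIntegral x Φ t) (pathDeriv Ψ t)) := by
  have hT0 := (hT.pos hx).le
  have hΨ' := hΨ.continuousOn_pathDeriv.mono hT.Icc_subset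
  have hsandwich := continuousOn_sandwich hx hΦ hT
  simp only [mul_add]
  rw [intervalIntegral.integral_sub
      ((continuousOn_pairing (continuousOn_inv_hatPath hx hΦ hT) hΨ').intervalIntegrable_of_Icc hT0)
      ((continuousOn_pairing hsandwich
        ((continuousOn_hatPath hx hΨ).mono hT.Icc_subset)).intervalIntegrable_of_Icc hT0),
    intervalIntegral.integral_add
      (hx.intervalIntegrable_mul_of_continuousOn (hT.mem_Icc hx)
        (continuousOn_pairing hsandwich (hΨ.continuousOn.mono hT.Icc_subset)))
      (hx.intervalIntegrable_mul_of_continuousOn (hT.mem_Icc hx)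
        (continuousOn_pairing (continuousOn_sandwichIntegral hx hΦ hT) hΨ')),
    integral_pairing_inv_hatPath hx hΦ hT hΨ, integral_pairing_sandwich_hatPath hx hΦ hT hx hΨ]
  ring

lemma integral_pairing_inv_hatPath_path_sub (hx : IsOrderParameter m x) (hΦ : IsC1Path Q Φ)
    (hΨ : IsC1Path Q Ψ) (hT : IsCutoff Q x Φ T) (hΨΦ : EqOn Ψ Φ (Icc T m)) :
    ∫ t in (0 : ℝ)..T, (pairing (hatPath x Φ t)⁻¹ (pathDeriv Ψ t - pathDeriv Φ t)
        - pairing (sandwich x Φ t) (hatPath x Ψ t - hatPath x Φ t))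
      = -∫ t in (0 : ℝ)..T, x t * (pairing (sandwich x Φ t) (Ψ t - Φ t)
          + pairing (sandwichIntegral x Φ t) (pathDeriv Ψ t - pathDeriv Φ t)) := by
  have hT0 := (hT.pos hx).le
  have hhatT : hatPath x Ψ T = hatPath x Φ T := by
    have := hΦ.eqOn_pathDeriv hΨ.toIsDifferentiablePath ⟨hT0, hT.2.1⟩ hΨΦ
    ext i j
    refine intervalIntegral.integral_congr fun t ht => ?_
    simp only [this (uIcc_of_le hT.2.1.le ▸ ht)]
  have integrable {Θ : ℝ → Matrix (Fin m) (Fin m) ℝ} (hΘ : IsC1Path Q Θ) :=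
    ((continuousOn_pairing (continuousOn_inv_hatPath hx hΦ hT)
        (hΘ.continuousOn_pathDeriv.mono hT.Icc_subset)).sub
      (continuousOn_pairing (continuousOn_sandwich hx hΦ hT)
        ((continuousOn_hatPath hx hΘ).mono hT.Icc_subset))).intervalIntegrable_of_Icc
          (μ := volume) hT0
  have integrable_mul {Θ : ℝ → Matrix (Fin m) (Fin m) ℝ} (hΘ : IsC1Path Q Θ) :=
    hx.intervalIntegrable_mul_of_continuousOn (hT.mem_Icc hx)
      ((continuousOn_pairing (continuousOn_sandwich hx hΦ hT)
        (hΘ.continuousOn.mono hT.Icc_subset)).add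
      (continuousOn_pairing (continuousOn_sandwichIntegral hx hΦ hT)
        (hΘ.continuousOn_pathDeriv.mono hT.Icc_subset)))
  have hleft := intervalIntegral.integral_sub (integrable hΨ) (integrable hΦ)
  have hright := intervalIntegral.integral_sub (integrable_mul hΨ) (integrable_mul hΦ)
  simp only [Pi.add_apply, Pi.sub_apply] at hleft hright
  rw [integral_pairing_inv_hatPath_sub_sandwich hx hΦ hT hΨ,
    integral_pairing_inv_hatPath_sub_sandwich hx hΦ hT hΦ, hhatT,
    hΨΦ (left_mem_Icc.2 hT.2.1.le), sub_sub_sub_cancel_left, ← neg_sub, ← hright] at hleft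
  simp only [pairing_sub_right, sub_add_sub_comm, mul_sub] at hleft ⊢
  simpa only [sub_sub_sub_comm] using hleft

lemma hasDerivAt_integral_pairing_inv_hatPath_path (hx : IsOrderParameter m x)
    (hΦ : IsC1Path Q Φ) (hΨ : IsC1Path Q Ψ) (hT : IsCutoff Q x Φ T) (hΨΦ : EqOn Ψ Φ (Icc T m)) :
    HasDerivAt (fun ε : ℝ => ∫ t in (0 : ℝ)..T,
        pairing (hatPath x (Φ + ε • (Ψ - Φ)) t)⁻¹ (pathDeriv (Φ + ε • (Ψ - Φ)) t))
      (-∫ t in (0 : ℝ)..T, x t * (pairing (sandwich x Φ t) (Ψ t - Φ t)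
        + pairing (sandwichIntegral x Φ t) (pathDeriv Ψ t - pathDeriv Φ t))) 0 := by
  have hT0 := (hT.pos hx).le
  have hderiv := hasDerivAt_integral_pairing_inv hT0
    ((continuousOn_hatPath hx hΦ).mono hT.Icc_subset)
    (((continuousOn_hatPath hx hΨ).sub (continuousOn_hatPath hx hΦ)).mono hT.Icc_subset)
    (hΦ.continuousOn_pathDeriv.mono hT.Icc_subset)
    ((hΨ.continuousOn_pathDeriv.sub hΦ.continuousOn_pathDeriv).mono hT.Icc_subset)
    fun t ht => det_hatPath_ne_zero hx hΦ hT ht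
  simp only [pairing_inv_mul_mul_inv_pathDeriv, Pi.sub_apply] at hderiv
  refine (hderiv.congr_deriv (integral_pairing_inv_hatPath_path_sub hx hΦ hΨ hT hΨΦ)
    ).congr_of_eventuallyEq (.of_forall fun ε => intervalIntegral.integral_congr fun t ht => ?_)
  have ht' := hT.Icc_subset (uIcc_of_le hT0 ▸ ht)
  simp only [hatPath_add_smul_sub_right hx hΦ hΨ ε ht',
    hΦ.pathDeriv_add_smul_sub hΨ.toIsDifferentiablePath ε ht']

lemma hasDerivAt_crisantiSommers_path (hβ : IsSummableMixture β) (hQ : IsConstraint Q)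
    (hx : IsOrderParameter m x) (hΦ : IsC1Path Q Φ) (hΨ : IsC1Path Q Ψ) (hT : IsCutoff Q x Φ T)
    (hΨΦ : EqOn Ψ Φ (Icc T m)) :
    HasDerivAt (fun ε : ℝ => crisantiSommers β h T x (Φ + ε • (Ψ - Φ)))
      (1 / 2 * ∫ t in (0 : ℝ)..T, x t * (pairing (gradientDeriv β x Φ t) (Ψ t - Φ t)
        + pairing (gradient β x Φ t + Matrix.vecMulVec h h) (pathDeriv Ψ t - pathDeriv Φ t)))
      0 := by
  have hv := (hΨ.continuousOn.sub hΦ.continuousOn).mono hT.Icc_subset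
  have hv' := (hΨ.continuousOn_pathDeriv.sub hΦ.continuousOn_pathDeriv).mono hT.Icc_subset
  have hxi := hx.intervalIntegrable_mul_of_continuousOn (hT.mem_Icc hx)
    ((continuousOn_pairing
        ((continuousOn_xiSecondDeriv_hadamard_pathDeriv hβ hQ hΦ).mono hT.Icc_subset) hv).add
      (continuousOn_pairing (((continuousOn_xiDeriv_path hβ hQ hΦ.toIsDifferentiablePath).mono
        hT.Icc_subset).add (continuousOn_const (c := Matrix.vecMulVec h h))) hv'))
  have hsandwich := hx.intervalIntegrable_mul_of_continuousOn (hT.mem_Icc hx)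
    ((continuousOn_pairing (continuousOn_sandwich hx hΦ hT) hv).add
      (continuousOn_pairing (continuousOn_sandwichIntegral hx hΦ hT) hv'))
  have hderiv := ((((hasDerivAt_integral_pairing_xiDeriv_path (h := h) hβ hQ hx hΦ hΨ
    ⟨(hT.pos hx).le, hT.2.1⟩ hΨΦ).add_const (Real.log (Φ m - Φ T).det)).add
      (hasDerivAt_integral_pairing_inv_hatPath_path hx hΦ hΨ hT hΨΦ)).const_mul (1 / 2))
  refine (hderiv.congr_deriv ?_).congr_of_eventuallyEq (.of_forall fun ε => ?_)
  · rw [← sub_eq_add_neg]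
    congr 1
    refine (intervalIntegral.integral_sub hxi hsandwich).symm.trans
      (intervalIntegral.integral_congr fun t _ => ?_)
    simp only [gradient, gradientDeriv, pairing_add_left, pairing_sub_left, Pi.add_apply,
      Pi.sub_apply]
    ring
  · simp only [crisantiSommers, Pi.add_apply, Pi.smul_apply, Pi.sub_apply,
      hΨΦ (left_mem_Icc.2 hT.2.1.le), hΨΦ (right_mem_Icc.2 hT.2.1.le), sub_self, smul_zero,
      add_zero]

end Variation

section FirstOrderConditions

variable {β : ℕ → Fin m → ℝ} {h : Fin m → ℝ} {Q : Matrix (Fin m) (Fin m) ℝ} {x y : ℝ → ℝ}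
  {Φ Ψ : ℝ → Matrix (Fin m) (Fin m) ℝ} {T : ℝ}

lemma IsConstraint.trace_eq (hQ : IsConstraint Q) : Q.trace = m := by
  simp [Matrix.trace, hQ.diag]

lemma IsC1Minimizer.exists_isCutoff (hm : 0 < m) (hmin : IsC1Minimizer β h Q x Φ)
    (hQ : Q.trace = m) :
    ∃ T, IsCutoff Q x Φ T ∧ (Φ (topPoint m x)).trace < (Φ T).trace := by
  have hΦ := hmin.path.toIsDifferentiablePath
  have htop := hmin.orderParameter.topPoint_mem
  have hτ := hΦ.trace_mem hQ htop
  -- the last time at which the trace of `Φ` still equals its value at the top point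
  set S := traceInv Φ (Φ (topPoint m x)).trace
  have hS : S ∈ Icc 0 (m : ℝ) := hΦ.traceInv_mem hτ
  have hΦS : Φ S = Φ (topPoint m x) := hΦ.apply_traceInv_trace hQ htop
  have htopS : topPoint m x ≤ S := (hΦ.le_traceInv_iff hQ hτ htop).2 le_rfl
  have : Nonempty (Fin m) := ⟨⟨0, hm⟩⟩
  have hSm : S < m := hS.2.lt_of_ne fun heq => hmin.det_pos.ne' <| by
    rw [← hΦS, heq, hΦ.right_end, sub_self, Matrix.det_zero]
  have hdet : ContinuousWithinAt (fun t => (Q - Φ t).det) (Ioi S) S :=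
    ((continuous_id.matrix_det.comp_continuousOn
      (continuousOn_const.sub hΦ.continuousOn)) S hS).mono_of_mem_nhdsWithin
        (mem_of_superset (Ioo_mem_nhdsGT hSm) fun _ ht => ⟨hS.1.trans ht.1.le, ht.2.le⟩)
  have hdetS : 0 < (Q - Φ S).det := hΦS ▸ hmin.det_pos
  obtain ⟨T, hT, hTdet⟩ :=
    (Filter.Eventually.and (Ioo_mem_nhdsGT hSm) (hdet.eventually (lt_mem_nhds hdetS))).exists
  refine ⟨T, ⟨htopS.trans_lt hT.1, hT.2, hTdet⟩, lt_of_not_ge fun hle => hT.1.not_ge ?_⟩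
  exact (hΦ.le_traceInv_iff hQ hτ ⟨hS.1.trans hT.1.le, hT.2.le⟩).2 hle

lemma IsC1Minimizer.integral_orderParameter_sub_mul_nonneg (hmin : IsC1Minimizer β h Q x Φ)
    (hβ : IsSummableMixture β) (hQ : IsConstraint Q) (hT : IsCutoff Q x Φ T)
    (htrace : (Φ (topPoint m x)).trace < (Φ T).trace) (hy : IsOrderParameter m y)
    (hyx : EqOn y x (Icc (topPoint m x) m)) :
    0 ≤ ∫ t in (0 : ℝ)..T, (y t - x t)
      * pairing (gradient β x Φ t + Matrix.vecMulVec h h) (pathDeriv Φ t) := by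
  have hx := hmin.orderParameter
  have hder := hasDerivAt_crisantiSommers_orderParameter (h := h) hβ hQ hx hmin.path hT hy
    (hyx.mono (Icc_subset_Icc_left hT.1.le))
  refine nonneg_of_mul_nonneg_right (nonneg_of_hasDerivAt_of_le hder fun ε hε => ?_)
    one_half_pos
  have hxε := hx.add_smul_sub hy hε
  have htop : topPoint m (x + ε • (y - x)) ≤ topPoint m x := topPoint_le hx.topPoint_mem <| by
    simp [hyx ⟨le_rfl, hx.topPoint_mem.2⟩, hx.apply_topPoint]
  rw [zero_smul, add_zero]
  exact hmin.le_of_isDifferentiablePath hQ.trace_eq hT hxε hmin.path.toIsDifferentiablePath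
    ⟨htop.trans_lt hT.1, hT.2⟩
    ((hmin.path.monotoneOn_trace hxε.topPoint_mem hx.topPoint_mem htop).trans_lt htrace)

lemma IsC1Minimizer.integral_mul_deriv_pairing_sub_path_nonneg
    (hmin : IsC1Minimizer β h Q x Φ) (hβ : IsSummableMixture β) (hQ : IsConstraint Q)
    (hT : IsCutoff Q x Φ T) (htrace : (Φ (topPoint m x)).trace < (Φ T).trace)
    (hΨ : IsC1Path Q Ψ) (hΨΦ : EqOn Ψ Φ (Icc (topPoint m x) m)) :
    0 ≤ ∫ t in (0 : ℝ)..T, x t * (pairing (gradientDeriv β x Φ t) (Ψ t - Φ t)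
      + pairing (gradient β x Φ t + Matrix.vecMulVec h h) (pathDeriv Ψ t - pathDeriv Φ t)) := by
  have hx := hmin.orderParameter
  have hder := hasDerivAt_crisantiSommers_path (h := h) hβ hQ hx hmin.path hΨ hT
    (hΨΦ.mono (Icc_subset_Icc_left hT.1.le))
  refine nonneg_of_mul_nonneg_right (nonneg_of_hasDerivAt_of_le hder fun ε hε => ?_)
    one_half_pos
  have hΦε {t : ℝ} (ht : t ∈ Icc (topPoint m x) m) : (Φ + ε • (Ψ - Φ)) t = Φ t := by
    simp [hΨΦ ht]
  have hΦT := hΦε ⟨hT.1.le, hT.2.1.le⟩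
  rw [zero_smul, add_zero]
  refine hmin.le_of_isDifferentiablePath hQ.trace_eq hT hx
    (hmin.path.add_smul_sub hΨ.toIsDifferentiablePath hε) ⟨hT.1, hT.2.1, ?_⟩ ?_
  · rw [hΦT]
    exact hT.2.2
  · rwa [hΦT, hΦε ⟨le_rfl, hx.topPoint_mem.2⟩]

end FirstOrderConditions

section Distribution

variable {β : ℕ → Fin m → ℝ} {h : Fin m → ℝ} {Q : Matrix (Fin m) (Fin m) ℝ} {x : ℝ → ℝ}
  {Φ Ψ : ℝ → Matrix (Fin m) (Fin m) ℝ} {μ : Measure ℝ} {T : ℝ}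

lemma integral_measureReal_Icc_mul_deriv {ν : Measure ℝ} [IsFiniteMeasure ν] {a b : ℝ}
    (hab : a ≤ b) {p p' : ℝ → ℝ} (hp : ∀ t ∈ Icc a b, HasDerivWithinAt p (p' t) (Icc a b) t)
    (hp' : ContinuousOn p' (Icc a b)) :
    ∫ t in a..b, ν.real (Icc a t) * p' t = ∫ s in Icc a b, (p b - p s) ∂ν := by
  set f : ℝ × ℝ → ℝ := indicator {z | z.2 ≤ z.1} fun z => p' z.1
  have hf : Integrable f ((volume.restrict (Icc a b)).prod (ν.restrict (Icc a b))) :=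
    (hp'.integrableOn_Icc.comp_fst _).indicator (measurableSet_le measurable_snd measurable_fst)
  have integral_snd (t : ℝ) (ht : t ∈ Icc a b) :
      ∫ s in Icc a b, f (t, s) ∂ν = ν.real (Icc a t) * p' t := by
    have hinter : Iic t ∩ Icc a b = Icc a t := by
      rw [← Ici_inter_Iic, inter_left_comm, Iic_inter_Iic, min_eq_left ht.2, Ici_inter_Iic]
    have : (fun s => f (t, s)) = indicator (Iic t) fun _ => p' t := by ext; simp [f, indicator]
    rw [this, integral_indicator_const _ measurableSet_Iic,
      measureReal_restrict_apply measurableSet_Iic, hinter, smul_eq_mul]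
  have integral_fst (s : ℝ) (hs : s ∈ Icc a b) : ∫ t in Icc a b, f (t, s) = p b - p s := by
    have hsub : Icc s b ⊆ Icc a b := Icc_subset_Icc_left hs.1
    have hinter : Icc a b ∩ Ici s = Icc s b := by
      rw [← Ici_inter_Iic, inter_right_comm, Ici_inter_Ici, max_eq_right hs.1, Ici_inter_Iic]
    have : (fun t => f (t, s)) = indicator (Ici s) p' := by ext; simp [f, indicator]
    rw [this, setIntegral_indicator measurableSet_Ici, hinter, integral_Icc_eq_integral_Ioc,
      ← intervalIntegral.integral_of_le hs.2]
    exact intervalIntegral.integral_eq_sub_of_hasDerivAt_of_le hs.2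
      (fun t ht => (hp t (hsub ht)).continuousWithinAt.mono hsub)
      (fun t ht => (hp t (hsub (Ioo_subset_Icc_self ht))).hasDerivAt
        (Icc_mem_nhds (hs.1.trans_lt ht.1) ht.2))
      ((hp'.mono hsub).intervalIntegrable_of_Icc hs.2)
  rw [intervalIntegral.integral_of_le hab, ← integral_Icc_eq_integral_Ioc]
  calc ∫ t in Icc a b, ν.real (Icc a t) * p' t
      = ∫ t in Icc a b, ∫ s in Icc a b, f (t, s) ∂ν :=
        setIntegral_congr_fun measurableSet_Icc fun t ht => (integral_snd t ht).symm
    _ = ∫ s in Icc a b, (∫ t in Icc a b, f (t, s)) ∂ν := integral_integral_swap hf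
    _ = _ := setIntegral_congr_fun measurableSet_Icc integral_fst

lemma HasDistribution.measureReal_Icc (hμ : HasDistribution m x μ) (hx : IsOrderParameter m x)
    {t : ℝ} (ht : t ∈ Icc 0 (m : ℝ)) : μ.real (Icc 0 t) = x t := by
  rw [measureReal_def, hμ.measure_Icc t ht, ENNReal.toReal_ofReal (hx.nonneg t ht)]

lemma HasDistribution.isFiniteMeasure (hμ : HasDistribution m x μ) : IsFiniteMeasure μ := by
  refine ⟨?_⟩
  rw [← measure_add_measure_compl (measurableSet_Icc (a := (0 : ℝ)) (b := m)), hμ.measure_compl,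
    add_zero, hμ.measure_Icc m end_mem_timeInterval]
  exact ENNReal.ofReal_lt_top

lemma HasDistribution.measure_Ioc (hμ : HasDistribution m x μ) (hx : IsOrderParameter m x)
    {t : ℝ} (ht : t ∈ Icc 0 (m : ℝ)) : μ (Ioc 0 t) = ENNReal.ofReal (x t - x 0) := by
  have := hμ.isFiniteMeasure
  rw [← Icc_sdiff_left, ← Icc_self, measure_sdiff (by simpa using ht.1)
    measurableSet_Icc.nullMeasurableSet (measure_ne_top _ _), hμ.measure_Icc t ht,
    hμ.measure_Icc 0 zero_mem_timeInterval,
    ENNReal.ofReal_sub _ (hx.nonneg 0 zero_mem_timeInterval)]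

lemma HasDistribution.measure_Icc_eq_measure_singleton (hμ : HasDistribution m x μ)
    {q : ℝ} (hq : q ∈ Icc 0 (m : ℝ)) (hxq : x q = x 0) : μ (Icc 0 q) = μ {0} := by
  rw [← Icc_self, hμ.measure_Icc q hq, hμ.measure_Icc 0 zero_mem_timeInterval, hxq]

lemma IsC1Minimizer.setIntegral_pairing_gradient_sub_path_nonpos
    (hmin : IsC1Minimizer β h Q x Φ) (hβ : IsSummableMixture β) (hQ : IsConstraint Q)
    (hμ : HasDistribution m x μ) (hT : IsCutoff Q x Φ T)
    (htrace : (Φ (topPoint m x)).trace < (Φ T).trace) (hΨ : IsC1Path Q Ψ)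
    (hΨΦ : EqOn Ψ Φ (Icc (topPoint m x) m)) :
    ∫ t in Icc 0 T, pairing (gradient β x Φ t + Matrix.vecMulVec h h) (Ψ t - Φ t) ∂μ ≤ 0 := by
  have hx := hmin.orderParameter
  have hΦ := hmin.path
  have := hμ.isFiniteMeasure
  have hv := (hΨ.continuousOn.sub hΦ.continuousOn).mono hT.Icc_subset
  have hv' := (hΨ.continuousOn_pathDeriv.sub hΦ.continuousOn_pathDeriv).mono hT.Icc_subset
  have hderiv (t : ℝ) (ht : t ∈ Icc 0 T) :=
    hasDerivWithinAt_pairing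
      ((hasDerivWithinAt_gradient hβ hQ hx hΦ hT ht).add_const (Matrix.vecMulVec h h))
      (((hΨ.hasDerivWithinAt (hT.Icc_subset ht)).sub
        (hΦ.hasDerivWithinAt (hT.Icc_subset ht))).mono hT.Icc_subset)
  have hnonneg := hmin.integral_mul_deriv_pairing_sub_path_nonneg hβ hQ hT htrace hΨ hΨΦ
  have hfubini := integral_measureReal_Icc_mul_deriv (ν := μ) (hT.pos hx).le hderiv
    ((continuousOn_pairing (continuousOn_gradientDeriv hβ hQ hx hΦ hT) hv).add
      (continuousOn_pairing
        ((continuousOn_gradient hβ hQ hx hΦ hT).add continuousOn_const) hv'))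
  have hend : Ψ T - Φ T = 0 := sub_eq_zero.2 (hΨΦ ⟨hT.1.le, hT.2.1.le⟩)
  have hcongr : EqOn (fun t => μ.real (Icc 0 t) * (pairing (gradientDeriv β x Φ t) (Ψ t - Φ t)
        + pairing (gradient β x Φ t + Matrix.vecMulVec h h) (pathDeriv Ψ t - pathDeriv Φ t)))
      (fun t => x t * (pairing (gradientDeriv β x Φ t) (Ψ t - Φ t)
        + pairing (gradient β x Φ t + Matrix.vecMulVec h h) (pathDeriv Ψ t - pathDeriv Φ t)))
      (uIcc 0 T) := fun t ht => by
    rw [uIcc_of_le (hT.pos hx).le] at ht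
    simp only [hμ.measureReal_Icc hx (hT.Icc_subset ht)]
  rw [← intervalIntegral.integral_congr hcongr] at hnonneg
  have := hnonneg.trans_eq hfubini
  simp only [Pi.sub_apply, hend, pairing_zero_right, zero_sub, integral_neg] at this
  exact neg_nonneg.1 this

end Distribution

section TestPairs

variable {β : ℕ → Fin m → ℝ} {h : Fin m → ℝ} {Q : Matrix (Fin m) (Fin m) ℝ} {x : ℝ → ℝ}
  {Φ : ℝ → Matrix (Fin m) (Fin m) ℝ} {μ : Measure ℝ} {q T κ : ℝ}

lemma IsOrderParameter.ite_lt_max_sub (hx : IsOrderParameter m x) (hκ : 0 ≤ κ) (hqm : q ≤ m) :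
    IsOrderParameter m fun t => if t < q then max (x t - κ) 0 else x t where
  monotoneOn s hs t ht hst := by
    have hxst := hx.monotoneOn hs ht hst
    dsimp only
    split_ifs with h₁ h₂ h₂
    · exact max_le_max_right 0 (sub_le_sub_right hxst κ)
    · exact max_le (by linarith) (hx.nonneg t ht)
    · exact absurd (hst.trans_lt h₂) h₁
    · exact hxst
  rightContinuous t ht := by
    rcases lt_or_ge t q with h | h
    · have hmax : ContinuousWithinAt (fun s => max (x s - κ) 0) (Ici t) t :=
        ((hx.rightContinuous t ht).sub continuousWithinAt_const).sup continuousWithinAt_const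
      refine hmax.congr_of_eventuallyEq ?_ (if_pos h)
      filter_upwards [mem_nhdsWithin_of_mem_nhds (Iio_mem_nhds h)] with s hs using if_pos hs
    · exact (hx.rightContinuous t ht).congr (fun s hs => if_neg (h.trans hs).not_gt)
        (if_neg h.not_gt)
  nonneg t ht := by
    split_ifs
    exacts [le_max_right _ _, hx.nonneg t ht]
  right_end := by rw [if_neg hqm.not_gt, hx.right_end]

lemma IsC1Minimizer.integral_min_mul_pairing_gradient_nonpos (hmin : IsC1Minimizer β h Q x Φ)
    (hβ : IsSummableMixture β) (hQ : IsConstraint Q) (hT : IsCutoff Q x Φ T)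
    (htrace : (Φ (topPoint m x)).trace < (Φ T).trace) (hq : q ∈ Ioc 0 (topPoint m x))
    (hκ : 0 ≤ κ) :
    ∫ t in (0 : ℝ)..q, min (x t) κ
      * pairing (gradient β x Φ t + Matrix.vecMulVec h h) (pathDeriv Φ t) ≤ 0 := by
  have hx := hmin.orderParameter
  have hy := hx.ite_lt_max_sub hκ (hq.2.trans hx.topPoint_mem.2)
  have hqT : q ≤ T := hq.2.trans hT.1.le
  have hnonneg := hmin.integral_orderParameter_sub_mul_nonneg hβ hQ hT htrace hy fun t ht =>
    if_neg (hq.2.trans ht.1).not_gt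
  have hF : ContinuousOn (fun t => pairing (gradient β x Φ t + Matrix.vecMulVec h h)
      (pathDeriv Φ t)) (Icc 0 T) :=
    continuousOn_pairing ((continuousOn_gradient hβ hQ hx hmin.path hT).add continuousOn_const)
      (hmin.path.continuousOn_pathDeriv.mono hT.Icc_subset)
  rw [integral_eq_of_eqOn_zero ⟨hq.1.le, hqT⟩
    (((hy.intervalIntegrable zero_mem_timeInterval (hT.mem_Icc hx)).sub
      (hx.intervalIntegrable zero_mem_timeInterval (hT.mem_Icc hx))).mul_continuousOn
        (by rwa [uIcc_of_le (hT.pos hx).le]))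
    fun t ht => by simp [ht.1.not_gt]] at hnonneg
  rw [← neg_nonneg, ← intervalIntegral.integral_neg]
  refine hnonneg.trans_eq (intervalIntegral.integral_congr_Ioo_of_le hq.1.le fun t ht => ?_)
  simp only [if_pos ht.2, ← neg_mul]
  congr 1
  rcases le_total (x t) κ with hle | hle <;> simp [hle]

lemma IsOrderParameter.tendsto_integral_min_div_mul (hx : IsOrderParameter m x)
    (hpos : ∀ t ∈ Ioc 0 (m : ℝ), 0 < x t) (hq : q ∈ Ioc 0 (m : ℝ)) {F : ℝ → ℝ}
    (hF : IntervalIntegrable F volume 0 q) :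
    Tendsto (fun δ => ∫ t in (0 : ℝ)..q, min (x t) (x δ) / x δ * F t) (𝓝[>] 0)
      (𝓝 (∫ t in (0 : ℝ)..q, F t)) := by
  refine intervalIntegral.tendsto_integral_filter_of_dominated_convergence (fun t => |F t|)
    ?_ ?_ hF.abs (.of_forall fun t ht => ?_)
  · have hxq := hx.intervalIntegrable (b := q) zero_mem_timeInterval ⟨hq.1.le, hq.2⟩
    exact .of_forall fun δ =>
      ((hxq.def'.aestronglyMeasurable.inf aestronglyMeasurable_const).div₀
        aestronglyMeasurable_const).mul hF.def'.aestronglyMeasurable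
  · filter_upwards [Ioo_mem_nhdsGT hq.1] with δ hδ
    refine .of_forall fun t ht => ?_
    rw [uIoc_of_le hq.1.le] at ht
    have hδ0 := hpos δ ⟨hδ.1, hδ.2.le.trans hq.2⟩
    have ht0 := hx.nonneg t ⟨ht.1.le, ht.2.trans hq.2⟩
    rw [norm_mul, Real.norm_of_nonneg (div_nonneg (le_min ht0 hδ0.le) hδ0.le)]
    exact mul_le_of_le_one_left (abs_nonneg _) (div_le_one_of_le₀ (min_le_right _ _) hδ0.le)
  · -- the quotient is equal to `1` as soon as `δ ≤ t`
    rw [uIoc_of_le hq.1.le] at ht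
    refine tendsto_const_nhds.congr' ?_
    filter_upwards [Ioo_mem_nhdsGT ht.1] with δ hδ
    have hδm : δ ∈ Ioc 0 (m : ℝ) := ⟨hδ.1, hδ.2.le.trans (ht.2.trans hq.2)⟩
    rw [min_eq_right (hx.monotoneOn ⟨hδ.1.le, hδm.2⟩ ⟨ht.1.le, ht.2.trans hq.2⟩ hδ.2.le),
      div_self (hpos δ hδm).ne', one_mul]

lemma IsC1Minimizer.integral_pairing_gradient_pathDeriv_nonpos
    (hmin : IsC1Minimizer β h Q x Φ) (hβ : IsSummableMixture β) (hQ : IsConstraint Q)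
    (hT : IsCutoff Q x Φ T) (htrace : (Φ (topPoint m x)).trace < (Φ T).trace)
    (hpos : ∀ t ∈ Ioc 0 (m : ℝ), 0 < x t) (hq : q ∈ Ioc 0 (topPoint m x)) :
    ∫ t in (0 : ℝ)..q, pairing (gradient β x Φ t + Matrix.vecMulVec h h) (pathDeriv Φ t)
      ≤ 0 := by
  have hx := hmin.orderParameter
  have hqm : q ≤ m := hq.2.trans hx.topPoint_mem.2
  have hF : ContinuousOn (fun t => pairing (gradient β x Φ t + Matrix.vecMulVec h h)
      (pathDeriv Φ t)) (Icc 0 q) :=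
    (continuousOn_pairing ((continuousOn_gradient hβ hQ hx hmin.path hT).add continuousOn_const)
      (hmin.path.continuousOn_pathDeriv.mono hT.Icc_subset)).mono
        (Icc_subset_Icc_right (hq.2.trans hT.1.le))
  refine le_of_tendsto (hx.tendsto_integral_min_div_mul hpos ⟨hq.1, hqm⟩
    (hF.intervalIntegrable_of_Icc hq.1.le)) ?_
  filter_upwards [Ioo_mem_nhdsGT hq.1] with δ hδ
  have hδ0 := hpos δ ⟨hδ.1, hδ.2.le.trans hqm⟩
  have htest := hmin.integral_min_mul_pairing_gradient_nonpos hβ hQ hT htrace hq hδ0.le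
  simp only [div_mul_eq_mul_div, intervalIntegral.integral_div]
  exact div_nonpos_of_nonpos_of_nonneg htest hδ0.le

lemma IsMonotonePath.one_sub_smul (hΦ : IsMonotonePath Q Φ) {η : ℝ → ℝ}
    (hη : AntitoneOn η (Icc 0 (m : ℝ))) (hη0 : η 0 ≤ 1) (hηm : η m = 0) :
    IsMonotonePath Q fun t => (1 - η t) • Φ t := by
  have hη1 (t : ℝ) (ht : t ∈ Icc 0 (m : ℝ)) : 0 ≤ 1 - η t :=
    sub_nonneg.2 ((hη zero_mem_timeInterval ht ht.1).trans hη0)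
  refine ⟨fun t ht => (hΦ.posSemidef t ht).smul (hη1 t ht), fun s hs t ht hst => ?_, ?_, ?_⟩
  · convert ((hΦ.monotone s hs t ht hst).smul (hη1 t ht)).add
      ((hΦ.posSemidef s hs).smul (sub_nonneg.2 (hη hs ht hst))) using 1
    module
  · rw [hΦ.left_end, smul_zero]
  · rw [hηm, sub_zero, one_smul, hΦ.right_end]

lemma IsC1Path.one_sub_smul (hΦ : IsC1Path Q Φ) {η : ℝ → ℝ} (hη : ContDiff ℝ 1 η)
    (hanti : AntitoneOn η (Icc 0 (m : ℝ))) (hη0 : η 0 ≤ 1) (hηm : η m = 0) :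
    IsC1Path Q fun t => (1 - η t) • Φ t := by
  have hderiv (t : ℝ) (ht : t ∈ Icc 0 (m : ℝ)) : HasDerivWithinAt (fun t => (1 - η t) • Φ t)
      ((1 - η t) • pathDeriv Φ t + -deriv η t • Φ t) (Icc 0 (m : ℝ)) t :=
    (((hη.differentiable one_ne_zero t).hasDerivAt.const_sub 1).hasDerivWithinAt).smul
      (hΦ.hasDerivWithinAt ht)
  refine ⟨⟨hΦ.toIsMonotonePath.one_sub_smul hanti hη0 hηm,
    fun t ht => (hderiv t ht).differentiableWithinAt⟩, ?_⟩
  have hcont : ContinuousOn (fun t => (1 - η t) • pathDeriv Φ t + -deriv η t • Φ t)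
      (Icc 0 (m : ℝ)) :=
    ((continuous_const.sub hη.continuous).continuousOn.smul hΦ.continuousOn_pathDeriv).add
      ((hη.continuous_deriv le_rfl).neg.continuousOn.smul hΦ.continuousOn)
  exact hcont.congr fun t ht => pathDeriv_eq_of_hasDerivWithinAt ht (hderiv t ht)

lemma IsC1Minimizer.setIntegral_smoothTransition_mul_pairing_gradient_nonneg
    (hmin : IsC1Minimizer β h Q x Φ) (hβ : IsSummableMixture β) (hQ : IsConstraint Q)
    (hμ : HasDistribution m x μ) (hT : IsCutoff Q x Φ T)
    (htrace : (Φ (topPoint m x)).trace < (Φ T).trace) (hq : q ∈ Ioc 0 (topPoint m x)) :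
    0 ≤ ∫ t in Icc 0 T, (1 - t / q).smoothTransition
      * pairing (gradient β x Φ t + Matrix.vecMulVec h h) (Φ t) ∂μ := by
  have eq_zero {t : ℝ} (ht : q ≤ t) : (1 - t / q).smoothTransition = 0 :=
    Real.smoothTransition.zero_of_nonpos (sub_nonpos.2 ((one_le_div hq.1).2 ht))
  have hanti : Antitone fun t : ℝ => (1 - t / q).smoothTransition := fun s t hst =>
    Real.smoothTransition.monotone (sub_le_sub_left (div_le_div_of_nonneg_right hst hq.1.le) 1)
  have hΨ := hmin.path.one_sub_smul (η := fun t : ℝ => (1 - t / q).smoothTransition)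
    (Real.smoothTransition.contDiff.comp (contDiff_const.sub (contDiff_id.div_const q)))
    (hanti.antitoneOn _) (Real.smoothTransition.le_one _)
    (eq_zero (hq.2.trans hmin.orderParameter.topPoint_mem.2))
  have htest := hmin.setIntegral_pairing_gradient_sub_path_nonpos hβ hQ hμ hT htrace hΨ
    fun t ht => by simp [eq_zero (hq.2.trans ht.1)]
  have hdiff (t : ℝ) : (1 - (1 - t / q).smoothTransition) • Φ t - Φ t
      = (-(1 - t / q).smoothTransition) • Φ t := by module
  simp only [hdiff, pairing_smul_right, neg_mul, integral_neg] at htest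
  exact neg_nonpos.1 htest

lemma IsC1Minimizer.measure_Ioo_eq_zero_of_pairing_gradient_neg
    (hmin : IsC1Minimizer β h Q x Φ) (hβ : IsSummableMixture β) (hQ : IsConstraint Q)
    (hμ : HasDistribution m x μ) (hT : IsCutoff Q x Φ T)
    (htrace : (Φ (topPoint m x)).trace < (Φ T).trace) (hq : q ∈ Ioc 0 (topPoint m x))
    (hneg : ∀ t ∈ Ioo 0 q, pairing (gradient β x Φ t + Matrix.vecMulVec h h) (Φ t) < 0) :
    μ (Ioo 0 q) = 0 := by
  have := hμ.isFiniteMeasure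
  set f : ℝ → ℝ := fun t => (1 - t / q).smoothTransition
    * pairing (gradient β x Φ t + Matrix.vecMulVec h h) (Φ t)
  have f_neg (t : ℝ) (ht : t ∈ Ioo 0 q) : f t < 0 :=
    mul_neg_of_pos_of_neg (Real.smoothTransition.pos_of_pos
      (sub_pos.2 ((div_lt_one hq.1).2 ht.2))) (hneg t ht)
  have f_nonpos (t : ℝ) (ht : t ∈ Icc 0 T) : f t ≤ 0 := by
    rcases ht.1.eq_or_lt with rfl | ht0
    · simp [f, hmin.path.left_end, pairing_zero_right]
    rcases lt_or_ge t q with htq | hqt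
    · exact (f_neg t ⟨ht0, htq⟩).le
    · simp [f, Real.smoothTransition.zero_of_nonpos (sub_nonpos.2 ((one_le_div hq.1).2 hqt))]
  have hf : ContinuousOn f (Icc 0 T) :=
    (Real.smoothTransition.continuous.comp (by fun_prop)).continuousOn.mul
      (continuousOn_pairing ((continuousOn_gradient hβ hQ hmin.orderParameter hmin.path hT).add
        continuousOn_const) (hmin.path.continuousOn.mono hT.Icc_subset))
  have hnonneg := hmin.setIntegral_smoothTransition_mul_pairing_gradient_nonneg hβ hQ hμ hT
    htrace hq
  have hzero : ∫ t in Icc 0 T, -f t ∂μ = 0 := by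
    rw [integral_neg, neg_eq_zero]
    exact le_antisymm (setIntegral_nonpos measurableSet_Icc f_nonpos) hnonneg
  have f_ae : -f =ᵐ[μ.restrict (Icc 0 T)] 0 :=
    (setIntegral_eq_zero_iff_of_nonneg_ae
      ((ae_restrict_iff' measurableSet_Icc).2 (.of_forall fun t ht => neg_nonneg.2 (f_nonpos t ht)))
      (hf.integrableOn_compact isCompact_Icc).neg).1 hzero
  refine measure_mono_null (fun t ht => ?_)
    ((ae_restrict_iff' measurableSet_Icc).1 f_ae)
  exact fun hft => (neg_pos.2 (f_neg t ht)).ne' (hft ⟨ht.1.le, ht.2.le.trans (hq.2.trans hT.1.le)⟩)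

end TestPairs

section Origin

variable {β : ℕ → Fin m → ℝ} {h : Fin m → ℝ} {Q : Matrix (Fin m) (Fin m) ℝ} {x : ℝ → ℝ}
  {Φ : ℝ → Matrix (Fin m) (Fin m) ℝ} {μ : Measure ℝ} {q T : ℝ}

lemma pairing_gradientDeriv_zero (hβ : IsSummableMixture β) (hΦ : IsDifferentiablePath Q Φ) :
    pairing (gradientDeriv β x Φ 0) (pathDeriv Φ 0)
      = 2 * pairing (Matrix.vecMulVec (β 2) (β 2)) (pathDeriv Φ 0 ⊙ pathDeriv Φ 0)
        - pairing ((hatPath x Φ 0)⁻¹ * pathDeriv Φ 0) ((hatPath x Φ 0)⁻¹ * pathDeriv Φ 0) := by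
  have hsymm : (pathDeriv Φ 0)ᵀ = pathDeriv Φ 0 :=
    (hΦ.posSemidef_pathDeriv zero_mem_timeInterval).isHermitian
  rw [gradientDeriv, pairing_sub_left, hΦ.left_end, xiSecondDeriv_zero hβ]
  congr 1
  · rw [Matrix.smul_hadamard, pairing_smul_left, pairing_hadamard_left hsymm]
  · simp only [pairing, sandwich, Matrix.mul_assoc]

lemma continuousOn_pairing_gradient_pathDeriv (hβ : IsSummableMixture β) (hQ : IsConstraint Q)
    (hx : IsOrderParameter m x) (hΦ : IsC1Path Q Φ) (hT : IsCutoff Q x Φ T) :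
    ContinuousOn (fun t => pairing (gradient β x Φ t) (pathDeriv Φ t)) (Icc 0 T) :=
  continuousOn_pairing (continuousOn_gradient hβ hQ hx hΦ hT)
    (hΦ.continuousOn_pathDeriv.mono hT.Icc_subset)

lemma tendsto_inv_smul_gradient (hβ : IsSummableMixture β) (hQ : IsConstraint Q)
    (hx : IsOrderParameter m x) (hΦ : IsC1Path Q Φ) (hT : IsCutoff Q x Φ T) :
    Tendsto (fun t : ℝ => t⁻¹ • gradient β x Φ t) (𝓝[>] 0) (𝓝 (gradientDeriv β x Φ 0)) :=
  tendsto_inv_smul_of_hasDerivWithinAt (hT.pos hx)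
    (hasDerivWithinAt_gradient hβ hQ hx hΦ hT (left_mem_Icc.2 (hT.pos hx).le))
    (gradient_zero hΦ.toIsMonotonePath)

lemma tendsto_pairing_gradient_pathDeriv_div (hβ : IsSummableMixture β) (hQ : IsConstraint Q)
    (hx : IsOrderParameter m x) (hΦ : IsC1Path Q Φ) (hT : IsCutoff Q x Φ T) :
    Tendsto (fun t => pairing (gradient β x Φ t) (pathDeriv Φ t) / t) (𝓝[>] 0)
      (𝓝 (pairing (gradientDeriv β x Φ 0) (pathDeriv Φ 0))) := by
  have hΦ' : Tendsto (pathDeriv Φ) (𝓝[>] 0) (𝓝 (pathDeriv Φ 0)) :=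
    (hΦ.continuousOn_pathDeriv 0 zero_mem_timeInterval).mono_left
      (nhdsWithin_le_of_mem (Icc_mem_nhdsGT ((hT.pos hx).trans hT.2.1)))
  refine (tendsto_pairing (tendsto_inv_smul_gradient hβ hQ hx hΦ hT) hΦ').congr fun t => ?_
  rw [pairing_smul_left, inv_mul_eq_div]

lemma tendsto_pairing_gradient_path_div_sq (hβ : IsSummableMixture β) (hQ : IsConstraint Q)
    (hx : IsOrderParameter m x) (hΦ : IsC1Path Q Φ) (hT : IsCutoff Q x Φ T) :
    Tendsto (fun t => pairing (gradient β x Φ t) (Φ t) / t ^ 2) (𝓝[>] 0)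
      (𝓝 (pairing (gradientDeriv β x Φ 0) (pathDeriv Φ 0))) := by
  have hΦ' : Tendsto (fun t : ℝ => t⁻¹ • Φ t) (𝓝[>] 0) (𝓝 (pathDeriv Φ 0)) :=
    tendsto_inv_smul_of_hasDerivWithinAt ((hT.pos hx).trans hT.2.1)
      (hΦ.hasDerivWithinAt zero_mem_timeInterval) hΦ.left_end
  refine (tendsto_pairing (tendsto_inv_smul_gradient hβ hQ hx hΦ hT) hΦ').congr fun t => ?_
  rw [pairing_smul_left, pairing_smul_right]
  ring

lemma integral_pairing_gradient_add_pathDeriv (hβ : IsSummableMixture β) (hQ : IsConstraint Q)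
    (hx : IsOrderParameter m x) (hΦ : IsC1Path Q Φ) (hT : IsCutoff Q x Φ T) (hq : q ∈ Icc 0 T)
    (H : Matrix (Fin m) (Fin m) ℝ) :
    ∫ t in (0 : ℝ)..q, pairing (gradient β x Φ t + H) (pathDeriv Φ t)
      = (∫ t in (0 : ℝ)..q, pairing (gradient β x Φ t) (pathDeriv Φ t)) + pairing H (Φ q) := by
  have hsub : Icc 0 q ⊆ Icc 0 (m : ℝ) := (Icc_subset_Icc_right hq.2).trans hT.Icc_subset
  have hG := ((continuousOn_pairing_gradient_pathDeriv hβ hQ hx hΦ hT).mono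
    (Icc_subset_Icc_right hq.2)).intervalIntegrable_of_Icc (μ := volume) hq.1
  have hH : IntervalIntegrable (fun t => pairing H (pathDeriv Φ t)) volume 0 q :=
    (continuousOn_pairing continuousOn_const
      (hΦ.continuousOn_pathDeriv.mono hsub)).intervalIntegrable_of_Icc hq.1
  simp only [pairing_add_left]
  rw [intervalIntegral.integral_add hG hH, intervalIntegral.integral_eq_sub_of_hasDerivAt_of_le
    hq.1 (f := fun t => pairing H (Φ t))
    (continuousOn_pairing continuousOn_const (hΦ.continuousOn.mono hsub)) (fun t ht => ?_) hH,
    hΦ.left_end, pairing_zero_right, sub_zero]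
  have hpath := (hΦ.hasDerivWithinAt (hsub (Ioo_subset_Icc_self ht))).hasDerivAt
    (Icc_mem_nhds ht.1 (ht.2.trans_le (hq.2.trans hT.2.1.le)))
  have := hasDerivWithinAt_univ.1 (hasDerivWithinAt_pairing
    (hasDerivWithinAt_const t univ H) hpath.hasDerivWithinAt)
  simpa [pairing_zero_left] using this

lemma IsC1Minimizer.integral_pairing_gradient_le (hmin : IsC1Minimizer β h Q x Φ)
    (hβ : IsSummableMixture β) (hQ : IsConstraint Q) (hT : IsCutoff Q x Φ T)
    (htrace : (Φ (topPoint m x)).trace < (Φ T).trace)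
    (hpos : ∀ t ∈ Ioc 0 (m : ℝ), 0 < x t) (hq : q ∈ Ioc 0 (topPoint m x)) :
    ∫ t in (0 : ℝ)..q, pairing (gradient β x Φ t) (pathDeriv Φ t)
      ≤ -pairing (Matrix.vecMulVec h h) (Φ q) := by
  have hnonpos := hmin.integral_pairing_gradient_pathDeriv_nonpos hβ hQ hT htrace hpos hq
  rw [integral_pairing_gradient_add_pathDeriv hβ hQ hmin.orderParameter hmin.path hT
    ⟨hq.1.le, hq.2.trans hT.1.le⟩] at hnonpos
  linarith

lemma tendsto_integral_pairing_gradient_div_sq (hβ : IsSummableMixture β) (hQ : IsConstraint Q)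
    (hx : IsOrderParameter m x) (hΦ : IsC1Path Q Φ) (hT : IsCutoff Q x Φ T) :
    Tendsto (fun q => (∫ t in (0 : ℝ)..q, pairing (gradient β x Φ t) (pathDeriv Φ t)) / q ^ 2)
      (𝓝[>] 0) (𝓝 (pairing (gradientDeriv β x Φ 0) (pathDeriv Φ 0) / 2)) :=
  tendsto_integral_div_sq (hT.pos hx) (continuousOn_pairing_gradient_pathDeriv hβ hQ hx hΦ hT)
    (tendsto_pairing_gradient_pathDeriv_div hβ hQ hx hΦ hT)

lemma IsC1Minimizer.pairing_gradientDeriv_nonpos (hmin : IsC1Minimizer β h Q x Φ)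
    (hβ : IsSummableMixture β) (hQ : IsConstraint Q) (hT : IsCutoff Q x Φ T)
    (htrace : (Φ (topPoint m x)).trace < (Φ T).trace)
    (hpos : ∀ t ∈ Ioc 0 (m : ℝ), 0 < x t) (htop : 0 < topPoint m x) :
    pairing (gradientDeriv β x Φ 0) (pathDeriv Φ 0) ≤ 0 := by
  have hx := hmin.orderParameter
  suffices pairing (gradientDeriv β x Φ 0) (pathDeriv Φ 0) / 2 ≤ 0 by linarith
  refine le_of_tendsto (tendsto_integral_pairing_gradient_div_sq hβ hQ hx hmin.path hT) ?_
  filter_upwards [Ioc_mem_nhdsGT htop] with q hq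
  have hfield := pairing_vecMulVec_nonneg
    (hmin.path.posSemidef q ⟨hq.1.le, hq.2.trans hx.topPoint_mem.2⟩) h
  exact div_nonpos_of_nonpos_of_nonneg ((hmin.integral_pairing_gradient_le hβ hQ hT htrace hpos
    hq).trans (neg_nonpos.2 hfield)) (sq_nonneg q)

lemma IsC1Minimizer.eventually_pairing_gradient_neg (hmin : IsC1Minimizer β h Q x Φ)
    (hβ : IsSummableMixture β) (hQ : IsConstraint Q) (hT : IsCutoff Q x Φ T)
    (htrace : (Φ (topPoint m x)).trace < (Φ T).trace)
    (hpos : ∀ t ∈ Ioc 0 (m : ℝ), 0 < x t) (htop : 0 < topPoint m x)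
    (hγ : pairing (gradientDeriv β x Φ 0) (pathDeriv Φ 0) < 0) :
    ∀ᶠ t in 𝓝[>] (0 : ℝ), pairing (gradient β x Φ t + Matrix.vecMulVec h h) (Φ t) < 0 := by
  have hx := hmin.orderParameter
  have hlim := (tendsto_pairing_gradient_path_div_sq hβ hQ hx hmin.path hT).sub
    (tendsto_integral_pairing_gradient_div_sq hβ hQ hx hmin.path hT)
  rw [sub_half] at hlim
  filter_upwards [hlim.eventually_lt_const (div_neg_of_neg_of_pos hγ two_pos), Ioc_mem_nhdsGT htop]
    with t hlt ht
  have hfield := hmin.integral_pairing_gradient_le hβ hQ hT htrace hpos ht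
  rw [← sub_div, div_lt_iff₀ (pow_pos ht.1 2), zero_mul] at hlt
  rw [pairing_add_left]
  linarith

lemma IsC1Minimizer.pairing_gradientDeriv_eq_zero (hmin : IsC1Minimizer β h Q x Φ)
    (hm : 0 < m) (hβ : IsSummableMixture β) (hQ : IsConstraint Q) (hμ : HasDistribution m x μ)
    (hlt : ∀ t ∈ Ioc 0 (m : ℝ), x 0 < x t) :
    pairing (gradientDeriv β x Φ 0) (pathDeriv Φ 0) = 0 := by
  have hx := hmin.orderParameter
  have hm0 : (0 : ℝ) < m := Nat.cast_pos.2 hm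
  have hpos (t : ℝ) (ht : t ∈ Ioc 0 (m : ℝ)) : 0 < x t :=
    (hx.nonneg 0 zero_mem_timeInterval).trans_lt (hlt t ht)
  have htop : 0 < topPoint m x := by
    refine hx.topPoint_mem.1.lt_of_ne fun heq => (hlt m ⟨hm0, le_rfl⟩).ne ?_
    rw [hx.right_end, heq, hx.apply_topPoint]
  obtain ⟨T, hT, htrace⟩ := hmin.exists_isCutoff hm hQ.trace_eq
  refine (hmin.pairing_gradientDeriv_nonpos hβ hQ hT htrace hpos htop).antisymm ?_
  by_contra! hγ
  obtain ⟨ρ, hρ, hneg⟩ := mem_nhdsGT_iff_exists_Ioo_subset.1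
    (hmin.eventually_pairing_gradient_neg hβ hQ hT htrace hpos htop hγ)
  have hq : min ρ (topPoint m x) ∈ Ioc 0 (topPoint m x) :=
    ⟨lt_min (mem_Ioi.1 hρ) htop, min_le_right _ _⟩
  have hzero := hmin.measure_Ioo_eq_zero_of_pairing_gradient_neg hβ hQ hμ hT htrace hq
    fun t ht => hneg ⟨ht.1, ht.2.trans_le (min_le_left _ _)⟩
  obtain ⟨r, hr0, hrq⟩ := exists_between hq.1
  have hrm : r ∈ Ioc 0 (m : ℝ) := ⟨hr0, hrq.le.trans (hq.2.trans hx.topPoint_mem.2)⟩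
  have hpositive : 0 < μ (Ioc 0 r) := by
    rw [hμ.measure_Ioc hx (Ioc_subset_Icc_self hrm)]
    exact ENNReal.ofReal_pos.2 (sub_pos.2 (hlt r hrm))
  exact hpositive.not_ge (hzero ▸ measure_mono (Ioc_subset_Ioo_right hrq))

end Origin

lemma support_inter_Ico_eq_singleton {μ : Measure ℝ} {a b : ℝ} (hab : a < b)
    (ha : a ∈ μ.support) (hμ : μ (Ioo a b) = 0) : μ.support ∩ Ico a b = {a} := by
  refine Subset.antisymm (fun t ht => ?_) (singleton_subset_iff.2 ⟨ha, left_mem_Ico.2 hab⟩)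
  by_contra hta
  exact ((Measure.mem_support_iff_forall t).1 ht.1 _
    (Ioo_mem_nhds (ht.2.1.lt_of_ne' hta) ht.2.2)).ne' hμ

end VectorSpin

end

open VectorSpin in
theorem mainTheorem12_general {m : ℕ} (hm : 1 ≤ m) {β : ℕ → Fin m → ℝ} {h : Fin m → ℝ}
    {Q : Matrix (Fin m) (Fin m) ℝ} {x : ℝ → ℝ} {μ : Measure ℝ}
    {Φ : ℝ → Matrix (Fin m) (Fin m) ℝ} (hβ : IsSummableMixture β) (hQ : IsConstraint Q)
    (hmin : IsC1Minimizer β h Q x Φ) (hμ : HasDistribution m x μ) (h0 : 0 ∈ μ.support)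
    (hne : 2 * pairing (Matrix.vecMulVec (β 2) (β 2)) (pathDeriv Φ 0 ⊙ pathDeriv Φ 0)
        ≠ pairing ((hatPath x Φ 0)⁻¹ * pathDeriv Φ 0) ((hatPath x Φ 0)⁻¹ * pathDeriv Φ 0)) :
    ∃ q : ℝ, 0 < q ∧ q ≤ m ∧ μ (Icc 0 q) = μ {0} ∧ μ.support ∩ Ico 0 q = {0} := by
  have hx := hmin.orderParameter
  obtain ⟨q, hq, hxq⟩ : ∃ q ∈ Ioc 0 (m : ℝ), x q ≤ x 0 := by
    by_contra! hlt
    have hγ := hmin.pairing_gradientDeriv_eq_zero hm hβ hQ hμ hlt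
    rw [pairing_gradientDeriv_zero hβ hmin.path.toIsDifferentiablePath, sub_eq_zero] at hγ
    exact hne hγ
  have hqm : q ∈ Icc 0 (m : ℝ) := Ioc_subset_Icc_self hq
  have hμq : μ (Ioc 0 q) = 0 := by
    rw [hμ.measure_Ioc hx hqm, ENNReal.ofReal_of_nonpos (sub_nonpos.2 hxq)]
  have hxq' : x q = x 0 := hxq.antisymm (hx.monotoneOn zero_mem_timeInterval hqm hq.1.le)
  exact ⟨q, hq.1, hq.2, hμ.measure_Icc_eq_measure_singleton hqm hxq',
    support_inter_Ico_eq_singleton hq.1 h0 (measure_mono_null Ioo_subset_Ioc_self hμq)⟩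

theorem mainTheorem12 {m : ℕ} (hm : 1 ≤ m)
    (β : ℕ → Fin m → ℝ) (hβ : VectorSpin.IsMixture β) (h : Fin m → ℝ)
    (Q : Matrix (Fin m) (Fin m) ℝ) (hQ : VectorSpin.IsConstraint Q)
    (x : ℝ → ℝ) (μP : Measure ℝ) (Φ : ℝ → Matrix (Fin m) (Fin m) ℝ)
    (hmin : VectorSpin.IsMinimizer β h Q x μP Φ)
    (h0 : (0 : ℝ) ∈ μP.support)
    (hne : 2 * VectorSpin.pairing (Matrix.vecMulVec (β 2) (β 2))
          (VectorSpin.pathDeriv Φ 0 ⊙ VectorSpin.pathDeriv Φ 0)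
        ≠ VectorSpin.pairing ((VectorSpin.hatPath x Φ 0)⁻¹ * VectorSpin.pathDeriv Φ 0)
          ((VectorSpin.hatPath x Φ 0)⁻¹ * VectorSpin.pathDeriv Φ 0)) :
    ∃ q : ℝ, 0 < q ∧ q ≤ m ∧ μP (Icc 0 q) = μP {0} ∧ μP.support ∩ Ico 0 q = {0} :=
  mainTheorem12_general hm hβ.summable hQ hmin.isC1Minimizer hmin.distribution h0 hne
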